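/- Let $\mathcal F=\{\lambda\in\mathbb C\setminus\{0,1\} : |\lambda|\le 1,\ |1-\lambda|\le 1,\ \operatorname{Re}\lambda\le \tfrac12\}$. For $\lambda\in\mathcal F$ put $$\omega_1=\int_1^{\infty}\frac{dX}{\sqrt{X(X-1)(X-\lambda)}},\qquad \omega_2=\int_0^{-\infty}\frac{dX}{\sqrt{X(X-1)(X-\lambda)}},$$ with both integrals taken along the real line; for $\omega_1$ the square root is the one on the plane cut along the negative real axis with $\sqrt1=1$, and for $\omega_2$ the one on the plane cut along the positive real axis with $\sqrt{-1}=i$. Let $\Omega_\lambda=\mathbb Z\omega_1+\mathbb Z\omega_2$ (the period lattice of $dX/2Y$ on $Y^2=X(X-1)(X-\lambda)$), let $$\sigma_\lambda(z)=z\prod_{w\in\Omega_\lambda\setminus\{0\}}\Bigl(1-\frac zw\Bigr)\exp\Bigl(\frac zw+\frac{z^2}{2w^2}\Bigr)$$ be its Weierstrass sigma function, and let $\mathfrak F_\lambda=\{r_1\omega_1+r_2\omega_2 : r_1,r_2\in[0,1),\ r_1^2+r_2^2\ne0\}$ be the fundamental parallelogram (with $0$ removed). Identify $\mathbb C$ with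 $\mathbb R^2$. (1) Let $L$ be the language of the real ordered field together with two binary function symbols $f$ and $g$. There is a single $L$-formula $\theta(x)$, without parameters, such that for every positive integer $n$ there is $\epsilon>0$ with the following property: for all $\lambda\in\mathcal F$ with $|\lambda|<\epsilon$, the subset of $\mathbb R$ defined by $\theta$ in the real ordered field has at least $n$ connected components, both when $f$ and $g$ are interpreted as the real and imaginary parts of the restriction of $\sigma_\lambda$ to $\mathfrak F_\lambda$ (extended by $0$ to $\mathbb R^2$), and when they are interpreted as the real and imaginary parts of $\sigma_\lambda$ on all of $\mathbb C$. (2) Consequently $\sigma$ has no definition uniform in the lattice: in no o-minimal expansion of the real ordered field is there a formula $\varphi(x_1,\dots,x_4;y_1,\dots,y_k)$ such that for every $\lambda\in\mathcal F$ there are parameters $b\in\mathbb R^k$ for which $\varphi(\cdot\,;b)$ defines the graph of $\sigma_\lambda|_{\mathfrak F_\lambda}$ as a subset of $\mathbb R^4$. In particular, the function $(\lambda,z)\mapsto\sigma_\lambda(z)$ on $\{(\lambda,z):\lambda\in\mathcal F,\ z\in\mathfrak F_\lambda\}$ is not definable in any o-minimal expansion of the real ordered field. -/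

import Mathlib

universe u v

noncomputable section

namespace SigmaUniform

open FirstOrder Set

/-- `Γ ∩ {Re ≤ 1/2}`, where `Γ = {lam ≠ 0, 1 : |lam| ≤ 1, |1 - lam| ≤ 1}`. -/
def legendreDomain : Set ℂ :=
  {lam | lam ≠ 0 ∧ lam ≠ 1 ∧ ‖lam‖ ≤ 1 ∧ ‖1 - lam‖ ≤ 1 ∧ lam.re ≤ 1 / 2}

/-- The square root on the plane cut along the positive real axis, normalised by
`√(-1) = i`. (`Complex.sqrt` is the root on the plane cut along the negative real axis, with
`√1 = 1`.) -/
def sqrtCutPos (w : ℂ) : ℂ := Complex.I * Complex.sqrt (-w)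

/-- `ω₁ = ∫_1^∞ dX / √(X (X - 1) (X - lam))` along the real line. -/
def omega₁ (lam : ℂ) : ℂ :=
  ∫ X in Ioi (1 : ℝ), 1 / Complex.sqrt ((X : ℂ) * (X - 1) * (X - lam))

/-- `ω₂ = ∫_0^{-∞} dX / √(X (X - 1) (X - lam))` along the real line, with the other branch of the
root; the sign accounts for the direction of integration. -/
def omega₂ (lam : ℂ) : ℂ :=
  -∫ X in Iio (0 : ℝ), 1 / sqrtCutPos ((X : ℂ) * (X - 1) * (X - lam))

/-- The lattice `ℤ ω₁ + ℤ ω₂`. -/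
def latticeOf (lam : ℂ) : Submodule ℤ ℂ := Submodule.span ℤ {omega₁ lam, omega₂ lam}

/-- The Weierstrass sigma function of a lattice `Λ`:
`σ(z) = z ∏_{w ∈ Λ, w ≠ 0} (1 - z / w) exp (z / w + (z / w)² / 2)`. -/
def weierstrassSigma (Λ : Submodule ℤ ℂ) (z : ℂ) : ℂ :=
  z * ∏' w : {w : Λ // w ≠ 0},
    (1 - z / ((w : Λ) : ℂ)) * Complex.exp (z / ((w : Λ) : ℂ) + (z / ((w : Λ) : ℂ)) ^ 2 / 2)

/-- The function `σ_lam`, for the lattice spanned by `ω₁` and `ω₂`. -/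
def sigma (lam : ℂ) : ℂ → ℂ := weierstrassSigma (latticeOf lam)

/-- The fundamental parallelogram
`{r₁ ω₁ + r₂ ω₂ : r₁, r₂ ∈ [0, 1), r₁² + r₂² ≠ 0}`, with `0` removed. -/
def fundParallelogram (lam : ℂ) : Set ℂ :=
  {z | ∃ r₁ ∈ Ico (0 : ℝ) 1, ∃ r₂ ∈ Ico (0 : ℝ) 1, r₁ ^ 2 + r₂ ^ 2 ≠ 0 ∧
    z = r₁ * omega₁ lam + r₂ * omega₂ lam}

/-- Two binary function symbols `f` and `g`. -/
inductive TwoFunc : ℕ → Type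
  | f : TwoFunc 2
  | g : TwoFunc 2

/-- The language with just the binary function symbols `f` and `g`. -/
def twoLang : Language := ⟨TwoFunc, fun _ => Empty⟩

/-- The language of ordered rings `(+, *, -, 0, 1, ≤)` with two binary function symbols. -/
def fieldTwoLang : Language := (Language.ring.sum Language.order).sum twoLang

/-- The real ordered field, with `f` and `g` interpreted as the real and imaginary parts of
`h : ℂ → ℂ`, where `ℂ` is identified with `ℝ²`. -/
@[reducible]
def realStructure (h : ℂ → ℂ) : fieldTwoLang.Structure ℝ :=
  letI : Language.ring.Structure ℝ := (Ring.compatibleRingOfRing ℝ).toStructure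
  letI : Language.order.Structure ℝ := FirstOrder.Language.orderStructure ℝ
  letI : twoLang.Structure ℝ :=
    { funMap := fun {n} s =>
        match n, s with
        | _, .f => fun x => (h ⟨x 0, x 1⟩).re
        | _, .g => fun x => (h ⟨x 0, x 1⟩).im
      RelMap := fun r => r.elim }
  inferInstanceAs (((Language.ring.sum Language.order).sum twoLang).Structure ℝ)

/-- The subset of `ℝ` defined by the formula `θ(x)`, without parameters, when `f` and `g` are
interpreted as the real and imaginary parts of `h`. -/
def definedSet (θ : fieldTwoLang.Formula (Fin 1)) (h : ℂ → ℂ) : Set ℝ :=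
  {x | @Language.Formula.Realize fieldTwoLang ℝ (realStructure h) (Fin 1) θ ![x]}

/-- A structure on `ℝ` that is an o-minimal expansion of the real ordered field: order, addition
and multiplication are definable, and every subset of `ℝ` that is definable with parameters is a
finite union of intervals (points included). -/
structure IsOMinimalRealField (L : FirstOrder.Language.{u, v}) [L.Structure ℝ] : Prop where
  definable_le : (univ : Set ℝ).Definable L {p : Fin 2 → ℝ | p 0 ≤ p 1}
  definable_add : (univ : Set ℝ).Definable L {p : Fin 3 → ℝ | p 0 + p 1 = p 2}
  definable_mul : (univ : Set ℝ).Definable L {p : Fin 3 → ℝ | p 0 * p 1 = p 2}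
  finite_union : ∀ s : Set ℝ, (univ : Set ℝ).Definable₁ L s →
    ∃ C : Set (Set ℝ), C.Finite ∧ (∀ I ∈ C, I.OrdConnected) ∧ s = ⋃₀ C

/-- `φ` defines each graph of `σ_lam` on the fundamental parallelogram, as a subset of `ℝ⁴`, for
some choice of the parameters that may depend on `lam`. -/
def DefinesSigma {L : FirstOrder.Language.{u, v}} [L.Structure ℝ] {k : ℕ}
    (φ : L.Formula (Fin 4 ⊕ Fin k)) : Prop :=
  ∀ lam ∈ legendreDomain, ∃ b : Fin k → ℝ, ∀ p : Fin 4 → ℝ,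
    φ.Realize (Sum.elim p b) ↔
      ((⟨p 0, p 1⟩ : ℂ) ∈ fundParallelogram lam ∧ sigma lam ⟨p 0, p 1⟩ = ⟨p 2, p 3⟩)

end SigmaUniform

end

/-!
As `lam → 0` in the domain, `ω₁` tends to `π` (`tendsto_omega₁`) while `ω₂` tends to infinity in the
direction of `i` (`tendsto_im_omega₂`, `abs_re_omega₂_le`). Dominated convergence for infinite
products then shows that `σ_lam(z)` converges locally uniformly to the sigma function of `ℤ π`, which
by Euler's product for the sine and `∑ 1 / n² = π² / 6` is `sin z · exp (z² / 6)` (`tendsto_sigma`).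
On the line `z = 1 + i y` the factor `exp (z² / 6)` has argument `y / 3` and `sin z` stays in a fixed
sector, so the real part of the limit changes sign forever; and the half line `y > 0` is exhausted by
the fundamental parallelograms (`eventually_mem_fundParallelogram`). The number of sign changes of
`Re σ_lam(1 + i y)` inside the parallelogram is therefore unbounded as `lam → 0`.

The formula `0 < f(1, x)` turns this into arbitrarily many connected components, whatever the values
outside of the parallelogram are: points inside and outside of a subset of the line that alternate
`n` times already force `n` components (`natCast_le_card_connectedComponents`).

For the second part, a formula for the graphs yields a definable family of subsets `A_b` of the line
such that, for every `Y`, some `A_b` contains a unit interval, and omits one, in each window of fixed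
length in `[0, Y]`. This property of `(b, Y)` is definable, so it does not matter that the set of the
parameters coming from some `lam` need not be definable. Uniform finiteness is not needed either.
Definable choice selects one such `b` for each `Y`, and the pointwise limit of the selected sets
as `Y → ∞` is a definable subset of the line, hence constant near infinity. On a far away window the
selected sets then agree with a constant on a finite grid of mesh one, once `Y` is large, which
contradicts the unit intervals (`IsOMinimalRealField.not_forall_exists_alternates`).
-/

noncomputable section

namespace SigmaUniform

open FirstOrder Set Filter Topology MeasureTheory

/-! ### The first period -/

theorem complexSqrt_sq (z : ℂ) : Complex.sqrt z ^ 2 = z := by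
  simp [Complex.sqrt]

theorem norm_complexSqrt (z : ℂ) : ‖Complex.sqrt z‖ = √‖z‖ := by
  rw [eq_comm, Real.sqrt_eq_iff_mul_self_eq (norm_nonneg _) (norm_nonneg _), ← norm_mul, ← sq,
    complexSqrt_sq]

theorem complexSqrt_re_nonneg (z : ℂ) : 0 ≤ (Complex.sqrt z).re := by
  rw [Complex.sqrt, show (2⁻¹ : ℂ) = 2⁻¹ from rfl, Complex.cpow_inv_two_re]
  positivity

theorem measurable_complexSqrt : Measurable Complex.sqrt := by
  unfold Complex.sqrt
  fun_prop

theorem complexSqrt_ofReal_of_nonneg {x : ℝ} (hx : 0 ≤ x) : Complex.sqrt x = (√x : ℝ) := by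
  rw [Complex.sqrt, Real.sqrt_eq_rpow, Complex.ofReal_cpow hx]
  norm_num

theorem re_pos_of_mem_legendreDomain {lam : ℂ} (h : lam ∈ legendreDomain) : 0 < lam.re := by
  obtain ⟨h0, -, -, h1, -⟩ := h
  have h2 : ‖1 - lam‖ ^ 2 ≤ 1 := by nlinarith [norm_nonneg (1 - lam)]
  rw [Complex.sq_norm, Complex.normSq_apply] at h2
  simp only [Complex.sub_re, Complex.one_re, Complex.sub_im, Complex.one_im] at h2
  by_contra hre
  push Not at hre
  have h3 : lam.re ^ 2 + lam.im ^ 2 ≤ 0 := by nlinarith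
  exact h0 (Complex.ext (by simp; nlinarith [sq_nonneg lam.re, sq_nonneg lam.im])
    (by simp; nlinarith [sq_nonneg lam.re, sq_nonneg lam.im]))

theorem hasDerivAt_two_mul_arctan_sqrt_sub_one {x : ℝ} (hx : 1 < x) :
    HasDerivAt (fun x => 2 * Real.arctan √(x - 1)) (1 / (x * √(x - 1))) x := by
  have h0 : 0 < x - 1 := by linarith
  have h := ((((hasDerivAt_id' x).sub_const 1).sqrt h0.ne').arctan).const_mul 2
  refine h.congr_deriv ?_
  rw [Real.sq_sqrt h0.le]
  have : √(x - 1) ≠ 0 := (Real.sqrt_pos.2 h0).ne'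
  have : x ≠ 0 := by linarith
  field_simp
  ring

theorem continuous_two_mul_arctan_sqrt_sub_one :
    Continuous (fun x : ℝ => 2 * Real.arctan √(x - 1)) := by
  have := Real.continuous_arctan
  fun_prop

theorem tendsto_two_mul_arctan_sqrt_sub_one :
    Tendsto (fun x : ℝ => 2 * Real.arctan √(x - 1)) atTop (𝓝 Real.pi) := by
  have h1 : Tendsto (fun x : ℝ => √(x - 1)) atTop atTop :=
    Real.tendsto_sqrt_atTop.comp (tendsto_atTop_add_const_right _ _ tendsto_id)
  have h2 := ((tendsto_nhdsWithin_iff.1 Real.tendsto_arctan_atTop).1.comp h1).const_mul 2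
  rwa [mul_div_cancel₀ _ (two_ne_zero' ℝ)] at h2

theorem integrableOn_one_div_mul_sqrt_sub_one :
    IntegrableOn (fun x : ℝ => 1 / (x * √(x - 1))) (Ioi 1) :=
  integrableOn_Ioi_deriv_of_nonneg continuous_two_mul_arctan_sqrt_sub_one.continuousWithinAt
    (fun _ hx => hasDerivAt_two_mul_arctan_sqrt_sub_one hx)
    (fun x (hx : 1 < x) => by positivity)
    tendsto_two_mul_arctan_sqrt_sub_one

theorem integral_one_div_mul_sqrt_sub_one :
    ∫ x in Ioi (1 : ℝ), 1 / (x * √(x - 1)) = Real.pi := by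
  rw [integral_Ioi_of_hasDerivAt_of_nonneg
    continuous_two_mul_arctan_sqrt_sub_one.continuousWithinAt
    (fun _ hx => hasDerivAt_two_mul_arctan_sqrt_sub_one hx)
    (fun x (hx : 1 < x) => by positivity)
    tendsto_two_mul_arctan_sqrt_sub_one]
  simp

/-- At `lam = 0` the integrand is `1 / (X √(X - 1))`, the derivative of `2 arctan √(X - 1)`. -/
theorem tendsto_omega₁ : Tendsto omega₁ (𝓝 0) (𝓝 (Real.pi : ℂ)) := by
  have hval : ((∫ x in Ioi (1 : ℝ), 1 / (x * √(x - 1)) : ℝ) : ℂ) = (Real.pi : ℂ) := by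
    rw [integral_one_div_mul_sqrt_sub_one]
  rw [← hval, ← integral_complex_ofReal]
  refine tendsto_integral_filter_of_dominated_convergence
    (fun x => 2 * (1 / (x * √(x - 1)))) ?_ ?_
    (integrableOn_one_div_mul_sqrt_sub_one.const_mul 2) ?_
  · refine Eventually.of_forall fun lam => ?_
    have := measurable_complexSqrt
    exact Measurable.aestronglyMeasurable (by fun_prop)
  · have h : ∀ᶠ lam : ℂ in 𝓝 0, ‖lam‖ < 1 / 2 := by
      filter_upwards [Metric.ball_mem_nhds (0 : ℂ) (show (0 : ℝ) < 1 / 2 by norm_num)] with lam h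
      simpa using h
    filter_upwards [h] with lam hlam
    filter_upwards [ae_restrict_mem measurableSet_Ioi] with x hx
    have hx : 1 < x := hx
    have hn : x / 4 ≤ ‖(x : ℂ) - lam‖ := by
      have h1 := norm_sub_norm_le (x : ℂ) lam
      rw [Complex.norm_real, Real.norm_eq_abs, abs_of_pos (by linarith)] at h1
      linarith
    have h1 : ‖((x : ℂ) - 1)‖ = x - 1 := by
      rw [← Complex.ofReal_one, ← Complex.ofReal_sub, Complex.norm_real, Real.norm_eq_abs,
        abs_of_pos (by linarith)]
    rw [norm_div, norm_one, norm_complexSqrt, norm_mul, norm_mul, h1, Complex.norm_real,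
      Real.norm_eq_abs, abs_of_pos (by linarith)]
    have h2 : x * √(x - 1) / 2 ≤ √(x * (x - 1) * ‖(x : ℂ) - lam‖) := by
      apply Real.le_sqrt_of_sq_le
      rw [div_pow, mul_pow, Real.sq_sqrt (by linarith)]
      have h5 : 0 ≤ x * (x - 1) := by nlinarith
      nlinarith [mul_le_mul_of_nonneg_left hn h5]
    have h3 : 0 < x * √(x - 1) := mul_pos (by linarith) (Real.sqrt_pos.2 (by linarith))
    calc 1 / √(x * (x - 1) * ‖(x : ℂ) - lam‖) ≤ 1 / (x * √(x - 1) / 2) :=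
          one_div_le_one_div_of_le (by positivity) h2
      _ = 2 * (1 / (x * √(x - 1))) := by field_simp
  · filter_upwards [ae_restrict_mem measurableSet_Ioi] with x hx
    have hx : 1 < x := hx
    have hx' : 0 < x - 1 := by linarith
    have hp : 0 < x * (x - 1) * x := by positivity
    have hs : ((1 / (x * √(x - 1)) : ℝ) : ℂ) =
        1 / Complex.sqrt ((x : ℂ) * (x - 1) * (x - 0)) := by
      have : ((x : ℂ) * (x - 1) * (x - 0)) = ((x * (x - 1) * x : ℝ) : ℂ) := by push_cast; ring
      rw [this, complexSqrt_ofReal_of_nonneg hp.le,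
        show x * (x - 1) * x = x ^ 2 * (x - 1) by ring, Real.sqrt_mul (by positivity),
        Real.sqrt_sq (by linarith)]
      push_cast
      rfl
    rw [hs]
    have hne : Complex.sqrt ((x : ℂ) * (x - 1) * (x - 0)) ≠ 0 := by
      rw [← norm_ne_zero_iff, norm_complexSqrt]
      have : ((x : ℂ) * (x - 1) * (x - 0)) = ((x * (x - 1) * x : ℝ) : ℂ) := by push_cast; ring
      rw [this, Complex.norm_real, Real.norm_eq_abs, abs_of_pos hp]
      exact (Real.sqrt_pos.2 hp).ne'
    have hc : ContinuousAt Complex.sqrt ((x : ℂ) * (x - 1) * (x - 0)) := by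
      apply Complex.continuousAt_sqrt
      left
      have : ((x : ℂ) * (x - 1) * (x - 0)) = ((x * (x - 1) * x : ℝ) : ℂ) := by push_cast; ring
      rw [this, Complex.ofReal_re]
      exact hp.le
    refine Tendsto.div tendsto_const_nhds (Tendsto.comp hc ?_) hne
    exact Continuous.tendsto (f := fun lam : ℂ => (x : ℂ) * (x - 1) * (x - lam)) (by fun_prop) 0

/-! ### The second period -/

/-- The integrand of `omega₂ lam / I` after the substitution `X = -t`. -/
def periodIntegrand (lam : ℂ) (t : ℝ) : ℂ :=
  1 / Complex.sqrt ((t : ℂ) * (t + 1) * (t + lam))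

theorem omega₂_eq (lam : ℂ) :
    omega₂ lam = Complex.I * ∫ t in Ioi (0 : ℝ), periodIntegrand lam t := by
  rw [omega₂, ← integral_Iic_eq_integral_Iio, ← integral_const_mul, ← neg_zero,
    ← integral_comp_neg_Ioi, ← integral_neg, neg_zero]
  congr 1
  ext t
  have : -(((-t : ℝ) : ℂ) * ((-t : ℝ) - 1) * ((-t : ℝ) - lam)) =
      (t : ℂ) * (t + 1) * (t + lam) := by
    push_cast; ring
  rw [sqrtCutPos, periodIntegrand, this, ← div_div, one_div Complex.I, Complex.inv_I]
  ring

theorem le_norm_ofReal_add {lam : ℂ} (h : 0 < lam.re) (t : ℝ) :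
    t ≤ ‖(t : ℂ) + lam‖ := by
  refine le_trans ?_ (Complex.re_le_norm _)
  simp only [Complex.add_re, Complex.ofReal_re]
  linarith

theorem norm_le_norm_ofReal_add {lam : ℂ} (h : 0 < lam.re) {t : ℝ} (ht : 0 < t) :
    ‖lam‖ ≤ ‖(t : ℂ) + lam‖ := by
  rw [Complex.norm_def, Complex.norm_def]
  apply Real.sqrt_le_sqrt
  simp only [Complex.normSq_apply, Complex.add_re, Complex.ofReal_re, Complex.add_im,
    Complex.ofReal_im]
  nlinarith

theorem norm_radicand (lam : ℂ) {t : ℝ} (ht : 0 < t) :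
    ‖(t : ℂ) * (t + 1) * (t + lam)‖ = t * (t + 1) * ‖(t : ℂ) + lam‖ := by
  rw [norm_mul, norm_mul, Complex.norm_real, Real.norm_eq_abs, abs_of_pos ht]
  congr 2
  rw [← Complex.ofReal_one, ← Complex.ofReal_add, Complex.norm_real, Real.norm_eq_abs,
    abs_of_pos (by linarith)]

theorem radicand_eq (lam : ℂ) (t : ℝ) :
    (t : ℂ) * (t + 1) * (t + lam) = ((t * (t + 1) : ℝ) : ℂ) * (t + lam) := by
  push_cast; ring

theorem norm_periodIntegrand (lam : ℂ) {t : ℝ} (ht : 0 < t) :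
    ‖periodIntegrand lam t‖ = 1 / √(t * (t + 1) * ‖(t : ℂ) + lam‖) := by
  rw [periodIntegrand, norm_div, norm_one, norm_complexSqrt, norm_radicand lam ht]

/-- For `w` in the right half plane `√w` lies in the sector `|arg| < π / 4`, where
`|s| ≤ √2 Re s`; the constant `3 / 2` replaces `√2`. -/
theorem norm_complexSqrt_le_re {w : ℂ} (hw : 0 < w.re) :
    0 < ‖Complex.sqrt w‖ ∧ ‖Complex.sqrt w‖ ≤ 3 / 2 * (Complex.sqrt w).re := by
  set s := Complex.sqrt w with hs
  have hre : s.re ^ 2 - s.im ^ 2 = w.re := by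
    rw [← complexSqrt_sq w, ← hs, sq s, Complex.mul_re]; ring
  have h0 : 0 ≤ s.re := complexSqrt_re_nonneg w
  have hnsq : ‖s‖ ^ 2 = s.re ^ 2 + s.im ^ 2 := by
    rw [Complex.sq_norm, Complex.normSq_apply]; ring
  constructor
  · refine norm_pos_iff.2 fun h => ?_
    rw [h] at hre
    simp only [Complex.zero_re, Complex.zero_im] at hre
    linarith
  · apply abs_le_of_sq_le_sq' _ (by linarith) |>.2
    nlinarith [sq_nonneg s.im]

theorem le_re_one_div_complexSqrt {w : ℂ} (hw : 0 < w.re) :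
    1 / (3 / 2 * √‖w‖) ≤ (1 / Complex.sqrt w).re := by
  obtain ⟨hsp, h3⟩ := norm_complexSqrt_le_re hw
  rw [← norm_complexSqrt, one_div, one_div, Complex.inv_re, ← Complex.sq_norm, inv_eq_one_div,
    div_le_div_iff₀ (by positivity) (by positivity)]
  nlinarith

theorem abs_im_one_div_complexSqrt_le {w : ℂ} (hw : 0 < w.re) :
    |(1 / Complex.sqrt w).im| ≤ |w.im| / √‖w‖ ^ 3 := by
  obtain ⟨hsp, h3⟩ := norm_complexSqrt_le_re hw
  have h0 : 0 ≤ (Complex.sqrt w).re := complexSqrt_re_nonneg w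
  have him : 2 * (Complex.sqrt w).re * (Complex.sqrt w).im = w.im := by
    conv_rhs => rw [← complexSqrt_sq w, sq (Complex.sqrt w), Complex.mul_im]
    ring
  rw [← norm_complexSqrt, ← him]
  generalize Complex.sqrt w = s at *
  rw [one_div, Complex.inv_im, ← Complex.sq_norm, abs_div, abs_neg,
    abs_of_pos (by positivity : 0 < ‖s‖ ^ 2), div_le_div_iff₀ (by positivity) (by positivity),
    abs_mul, abs_of_nonneg (by linarith : 0 ≤ 2 * s.re)]
  have h4 : ‖s‖ ≤ 2 * s.re := by linarith
  nlinarith [mul_le_mul_of_nonneg_right h4 (by positivity : 0 ≤ |s.im| * ‖s‖ ^ 2)]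

theorem radicand_re_pos {lam : ℂ} (h : 0 < lam.re) {t : ℝ} (ht : 0 < t) :
    0 < ((t : ℂ) * (t + 1) * (t + lam)).re := by
  rw [radicand_eq, Complex.re_ofReal_mul, Complex.add_re, Complex.ofReal_re]
  positivity

theorem le_re_periodIntegrand {lam : ℂ} (h : 0 < lam.re) {t : ℝ} (ht : 0 < t) :
    1 / (3 / 2 * √(t * (t + 1) * ‖(t : ℂ) + lam‖)) ≤ (periodIntegrand lam t).re := by
  have := le_re_one_div_complexSqrt (radicand_re_pos h ht)
  rwa [norm_radicand lam ht] at this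

theorem abs_im_periodIntegrand_le {lam : ℂ} (h : 0 < lam.re) {t : ℝ} (ht : 0 < t) :
    |(periodIntegrand lam t).im| ≤ ‖lam‖ / (√t * √‖(t : ℂ) + lam‖ ^ 3) := by
  refine (abs_im_one_div_complexSqrt_le (radicand_re_pos h ht)).trans ?_
  rw [norm_radicand lam ht, radicand_eq, Complex.im_ofReal_mul, Complex.add_im, Complex.ofReal_im,
    zero_add, abs_mul, abs_of_pos (by positivity : 0 < t * (t + 1))]
  have hN : 0 < ‖(t : ℂ) + lam‖ := ht.trans_le (le_norm_ofReal_add h t)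
  rw [Real.sqrt_mul (by positivity), Real.sqrt_mul (by positivity)]
  have ha := Real.sq_sqrt ht.le
  have hb := Real.sq_sqrt (by positivity : 0 ≤ t + 1)
  have hb1 : 1 ≤ √(t + 1) := Real.one_le_sqrt.2 (by linarith)
  have hc : 0 < √‖(t : ℂ) + lam‖ := Real.sqrt_pos.2 hN
  have hd : 0 < √t := Real.sqrt_pos.2 ht
  have hk : t * (t + 1) * |lam.im| = √t ^ 2 * √(t + 1) ^ 2 * |lam.im| := by rw [ha, hb]
  rw [hk]
  generalize √‖(t : ℂ) + lam‖ = C at *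
  generalize √(t + 1) = B at *
  generalize √t = A at *
  have : A ^ 2 * B ^ 2 * |lam.im| / (A * B * C) ^ 3 = |lam.im| / (A * C ^ 3) / B := by
    field_simp
  rw [this]
  calc |lam.im| / (A * C ^ 3) / B ≤ |lam.im| / (A * C ^ 3) := div_le_self (by positivity) hb1
    _ ≤ _ := by gcongr; exact Complex.abs_im_le_norm lam

theorem measurable_periodIntegrand (lam : ℂ) : Measurable (periodIntegrand lam) := by
  have := measurable_complexSqrt
  unfold periodIntegrand
  fun_prop

theorem rpow_neg_half_eq {t : ℝ} (ht : 0 < t) : t ^ (-(1 / 2) : ℝ) = 1 / √t := by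
  rw [Real.rpow_neg ht.le, ← Real.sqrt_eq_rpow, one_div]

theorem integrableOn_rpow_neg_half {a : ℝ} (ha : 0 ≤ a) :
    IntegrableOn (fun t : ℝ => t ^ (-(1 / 2) : ℝ)) (Ioc 0 a) :=
  (intervalIntegrable_iff_integrableOn_Ioc_of_le ha).1
    (intervalIntegral.intervalIntegrable_rpow' (by norm_num))

theorem integrableOn_periodIntegrand {lam : ℂ} (h : 0 < lam.re) :
    IntegrableOn (periodIntegrand lam) (Ioi 0) := by
  have hl : 0 < ‖lam‖ := h.trans_le (Complex.re_le_norm _)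
  rw [← Ioc_union_Ioi_eq_Ioi (zero_le_one (α := ℝ))]
  refine IntegrableOn.union ?_ ?_
  · refine Integrable.mono' ((integrableOn_rpow_neg_half zero_le_one).const_mul (1 / √‖lam‖))
      (measurable_periodIntegrand lam).aestronglyMeasurable ?_
    filter_upwards [ae_restrict_mem measurableSet_Ioc] with t ht
    rw [norm_periodIntegrand lam ht.1, rpow_neg_half_eq ht.1, one_div_mul_one_div, mul_comm √‖lam‖,
      ← Real.sqrt_mul ht.1.le]
    have := norm_le_norm_ofReal_add h ht.1
    refine one_div_le_one_div_of_le (Real.sqrt_pos.2 (mul_pos ht.1 hl)) (Real.sqrt_le_sqrt ?_)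
    refine mul_le_mul ?_ this hl.le (by nlinarith [ht.1])
    nlinarith [ht.1]
  · refine Integrable.mono' (integrableOn_Ioi_rpow_of_lt (a := -(3 / 2)) (by norm_num)
      zero_lt_one) (measurable_periodIntegrand lam).aestronglyMeasurable ?_
    filter_upwards [ae_restrict_mem measurableSet_Ioi] with t ht
    have ht1 : (1 : ℝ) < t := ht
    have ht : 0 < t := by linarith
    have hh : t ^ (-(3 / 2) : ℝ) = 1 / √(t ^ 3) := by
      rw [Real.rpow_neg ht.le, Real.sqrt_eq_rpow, ← Real.rpow_natCast, ← Real.rpow_mul ht.le,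
        one_div]
      norm_num
    rw [norm_periodIntegrand lam ht, hh]
    have := le_norm_ofReal_add h t
    refine one_div_le_one_div_of_le (Real.sqrt_pos.2 (by positivity)) (Real.sqrt_le_sqrt ?_)
    calc t ^ 3 = t * t * t := by ring
      _ ≤ _ := by gcongr; linarith

/-- On `[|lam|, 1]` the real part of the integrand is at least `1 / (3 t)`, which produces the
logarithm. -/
theorem neg_log_div_three_le_re_integral {lam : ℂ} (h : 0 < lam.re) (h1 : ‖lam‖ ≤ 1) :
    -Real.log ‖lam‖ / 3 ≤ (∫ t in Ioi (0 : ℝ), periodIntegrand lam t).re := by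
  have hl : 0 < ‖lam‖ := h.trans_le (Complex.re_le_norm _)
  have hint := integrableOn_periodIntegrand h
  have hre : (∫ t in Ioi (0 : ℝ), periodIntegrand lam t).re =
      ∫ t in Ioi (0 : ℝ), (periodIntegrand lam t).re := (integral_re hint).symm
  rw [hre]
  have hpos : ∀ t ∈ Ioi (0 : ℝ), 0 ≤ (periodIntegrand lam t).re := fun t ht =>
    le_trans (by positivity) (le_re_periodIntegrand h ht)
  have hsub : Ioc ‖lam‖ 1 ⊆ Ioi 0 := fun t ht => hl.trans ht.1
  have hlog : ∫ t in Ioc ‖lam‖ 1, 1 / 3 * t⁻¹ = -Real.log ‖lam‖ / 3 := by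
    rw [← intervalIntegral.integral_of_le h1, intervalIntegral.integral_const_mul,
      integral_inv_of_pos hl one_pos, one_div ‖lam‖, Real.log_inv]
    ring
  rw [← hlog]
  have hint' : IntegrableOn (fun t => (periodIntegrand lam t).re) (Ioi 0) := hint.re
  refine le_trans (setIntegral_mono_on ?_ (hint'.mono_set hsub) measurableSet_Ioc ?_)
    (setIntegral_mono_set hint' ?_ hsub.eventuallyLE)
  · refine (intervalIntegrable_iff_integrableOn_Ioc_of_le h1).1 ?_
    refine (intervalIntegral.intervalIntegrable_inv (fun t ht => ?_) continuousOn_id).const_mul _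
    rw [uIcc_of_le h1] at ht
    exact (hl.trans_le ht.1).ne'
  · intro t ht
    have ht0 : 0 < t := hl.trans ht.1
    refine le_trans ?_ (le_re_periodIntegrand h ht0)
    rw [← one_div, one_div_mul_one_div]
    have hN := le_norm_ofReal_add h t
    have hN0 : 0 < ‖(t : ℂ) + lam‖ := ht0.trans_le hN
    refine one_div_le_one_div_of_le (by positivity) ?_
    have : √(t * (t + 1) * ‖(t : ℂ) + lam‖) ≤ 2 * t := by
      rw [Real.sqrt_le_left (by positivity)]
      have h3 : ‖(t : ℂ) + lam‖ ≤ 2 * t := by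
        refine (norm_add_le _ _).trans ?_
        rw [Complex.norm_real, Real.norm_eq_abs, abs_of_pos ht0]
        linarith [ht.1]
      calc t * (t + 1) * ‖(t : ℂ) + lam‖ ≤ t * 2 * (2 * t) := by gcongr; linarith [ht.2]
        _ = _ := by ring
    linarith
  · filter_upwards [ae_restrict_mem measurableSet_Ioi] with t ht using hpos t ht

/-- The imaginary part of the integrand is at most `(|lam| t)^(-1/2)` for `t ≤ |lam|` and at most
`|lam| / t²` for `t ≥ |lam|`; these bounds integrate to `2` and `1`. -/
theorem abs_im_integral_le {lam : ℂ} (h : 0 < lam.re) :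
    |(∫ t in Ioi (0 : ℝ), periodIntegrand lam t).im| ≤ 3 := by
  have hl : 0 < ‖lam‖ := h.trans_le (Complex.re_le_norm _)
  have hint := integrableOn_periodIntegrand h
  have him : (∫ t in Ioi (0 : ℝ), periodIntegrand lam t).im =
      ∫ t in Ioi (0 : ℝ), (periodIntegrand lam t).im := (integral_im hint).symm
  have hint' : IntegrableOn (fun t => (periodIntegrand lam t).im) (Ioi 0) := hint.im
  rw [him, ← Ioc_union_Ioi_eq_Ioi hl.le,
    setIntegral_union (Ioc_disjoint_Ioi le_rfl) measurableSet_Ioi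
      (hint'.mono_set Ioc_subset_Ioi_self) (hint'.mono_set (Ioi_subset_Ioi hl.le))]
  have h1 : |∫ t in Ioc 0 ‖lam‖, (periodIntegrand lam t).im| ≤ 2 := by
    have hb : ∫ t in Ioc 0 ‖lam‖, 1 / √‖lam‖ * t ^ (-(1 / 2) : ℝ) = 2 := by
      rw [← intervalIntegral.integral_of_le hl.le, intervalIntegral.integral_const_mul,
        integral_rpow (Or.inl (by norm_num))]
      norm_num
      rw [← Real.sqrt_eq_rpow]
      have : √‖lam‖ ≠ 0 := (Real.sqrt_pos.2 hl).ne'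
      field_simp
    rw [← hb, ← Real.norm_eq_abs]
    refine norm_integral_le_of_norm_le
      ((integrableOn_rpow_neg_half hl.le).const_mul (1 / √‖lam‖)) ?_
    filter_upwards [ae_restrict_mem measurableSet_Ioc] with t ht
    refine (abs_im_periodIntegrand_le h ht.1).trans ?_
    rw [rpow_neg_half_eq ht.1]
    have hs := Real.sqrt_le_sqrt (norm_le_norm_ofReal_add h ht.1)
    have hs0 := Real.sqrt_pos.2 hl
    have ht0 := Real.sqrt_pos.2 ht.1
    calc ‖lam‖ / (√t * √‖(t : ℂ) + lam‖ ^ 3) ≤ ‖lam‖ / (√t * √‖lam‖ ^ 3) := by gcongr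
      _ = √‖lam‖ ^ 2 / (√t * √‖lam‖ ^ 3) := by rw [Real.sq_sqrt hl.le]
      _ = 1 / √‖lam‖ * (1 / √t) := by field_simp
  have h2 : |∫ t in Ioi ‖lam‖, (periodIntegrand lam t).im| ≤ 1 := by
    have hb : ∫ t in Ioi ‖lam‖, ‖lam‖ * t ^ (-2 : ℝ) = 1 := by
      rw [integral_const_mul, integral_Ioi_rpow_of_lt (by norm_num) hl]
      norm_num
      rw [Real.rpow_neg_one]
      field_simp
    rw [← hb, ← Real.norm_eq_abs]
    refine norm_integral_le_of_norm_le
      ((integrableOn_Ioi_rpow_of_lt (a := -2) (by norm_num) hl).const_mul _) ?_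
    filter_upwards [ae_restrict_mem measurableSet_Ioi] with t ht
    have ht0 : 0 < t := hl.trans ht
    refine (abs_im_periodIntegrand_le h ht0).trans ?_
    have hs := Real.sqrt_le_sqrt (le_norm_ofReal_add h t)
    have hs0 := Real.sqrt_pos.2 ht0
    have hrp : t ^ (-2 : ℝ) = 1 / t ^ 2 := by
      rw [Real.rpow_neg ht0.le, one_div]
      norm_cast
    rw [hrp]
    calc ‖lam‖ / (√t * √‖(t : ℂ) + lam‖ ^ 3) ≤ ‖lam‖ / (√t * √t ^ 3) := by gcongr
      _ = ‖lam‖ / ((√t ^ 2) ^ 2) := by ring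
      _ = ‖lam‖ * (1 / t ^ 2) := by rw [Real.sq_sqrt ht0.le]; ring
  calc _ ≤ _ := abs_add_le _ _
    _ ≤ 2 + 1 := add_le_add h1 h2
    _ = 3 := by norm_num

theorem abs_re_omega₂_le {lam : ℂ} (h : lam ∈ legendreDomain) : |(omega₂ lam).re| ≤ 3 := by
  rw [omega₂_eq, Complex.I_mul_re, abs_neg]
  exact abs_im_integral_le (re_pos_of_mem_legendreDomain h)

theorem tendsto_im_omega₂ :
    Tendsto (fun lam => (omega₂ lam).im) (𝓝[legendreDomain] 0) atTop := by
  have h1 : Tendsto (fun lam : ℂ => ‖lam‖) (𝓝[legendreDomain] 0) (𝓝[>] 0) := by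
    refine tendsto_nhdsWithin_iff.2 ⟨?_, ?_⟩
    · exact (Continuous.tendsto' continuous_norm 0 0 norm_zero).mono_left nhdsWithin_le_nhds
    · filter_upwards [self_mem_nhdsWithin] with lam h using norm_pos_iff.2 h.1
  have h2 : Tendsto (fun lam : ℂ => -Real.log ‖lam‖ / 3) (𝓝[legendreDomain] 0) atTop :=
    (tendsto_neg_atBot_atTop.comp (Real.tendsto_log_nhdsGT_zero.comp h1)).atTop_div_const
      (by norm_num)
  refine tendsto_atTop_mono' _ ?_ h2
  filter_upwards [self_mem_nhdsWithin] with lam h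
  rw [omega₂_eq, Complex.I_mul_im]
  exact neg_log_div_three_le_re_integral (re_pos_of_mem_legendreDomain h) h.2.2.1

/-! ### The degeneration of the sigma function -/

/-- The elementary factor `(1 - u) exp (u + u² / 2)` of genus two. -/
def elementaryFactor (u : ℂ) : ℂ := (1 - u) * Complex.exp (u + u ^ 2 / 2)

@[simp] theorem elementaryFactor_zero : elementaryFactor 0 = 1 := by simp [elementaryFactor]

theorem continuous_elementaryFactor : Continuous elementaryFactor := by
  unfold elementaryFactor
  fun_prop

theorem elementaryFactor_mul_neg (u : ℂ) :
    elementaryFactor u * elementaryFactor (-u) = (1 - u ^ 2) * Complex.exp (u ^ 2) := by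
  have : elementaryFactor u * elementaryFactor (-u) = (1 - u ^ 2) *
      (Complex.exp (u + u ^ 2 / 2) * Complex.exp (-u + (-u) ^ 2 / 2)) := by
    unfold elementaryFactor
    ring
  rw [this, ← Complex.exp_add]
  ring_nf

/-- The elementary factor is `1 + O(u³)`, uniformly on bounded sets. -/
theorem exists_norm_elementaryFactor_sub_one_le {M : ℝ} (hM : 0 ≤ M) :
    ∃ C : ℝ, 0 ≤ C ∧ ∀ u : ℂ, ‖u‖ ≤ M → ‖elementaryFactor u - 1‖ ≤ C * ‖u‖ ^ 3 := by
  refine ⟨1 / 2 + 3 / 8 * M + 1 / 8 * M ^ 2 +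
    (1 + M) * ((1 + M / 2) ^ 3 * Real.exp (M * (1 + M / 2))), by positivity, fun u hu => ?_⟩
  set v := u + u ^ 2 / 2 with hv
  have hvn : ‖v‖ ≤ ‖u‖ * (1 + M / 2) := by
    calc ‖v‖ ≤ ‖u‖ + ‖u ^ 2 / 2‖ := norm_add_le _ _
      _ = ‖u‖ * (1 + ‖u‖ / 2) := by simp; ring
      _ ≤ _ := by gcongr
  have hR := Complex.norm_exp_sub_sum_le_norm_mul_exp v 3
  set R := Complex.exp v - ∑ m ∈ Finset.range 3, v ^ m / (m.factorial : ℂ) with hRdef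
  have hsum : ∑ m ∈ Finset.range 3, v ^ m / (m.factorial : ℂ) = 1 + v + v ^ 2 / 2 := by
    simp [Finset.sum_range_succ, Nat.factorial]
  have hexp : Complex.exp v = 1 + v + v ^ 2 / 2 + R := by rw [hRdef, hsum]; ring
  have hEq : elementaryFactor u - 1 =
      -(u ^ 3 * (1 / 2 + 3 / 8 * u + 1 / 8 * u ^ 2)) + (1 - u) * R := by
    rw [elementaryFactor, hexp, hv]
    ring
  have hR' : ‖R‖ ≤ ‖u‖ ^ 3 * ((1 + M / 2) ^ 3 * Real.exp (M * (1 + M / 2))) := by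
    calc ‖R‖ ≤ ‖v‖ ^ 3 * Real.exp ‖v‖ := hR
      _ ≤ (‖u‖ * (1 + M / 2)) ^ 3 * Real.exp (M * (1 + M / 2)) := by
        gcongr
        exact hvn.trans (by gcongr)
      _ = _ := by ring
  have h1 : ‖u ^ 3 * (1 / 2 + 3 / 8 * u + 1 / 8 * u ^ 2)‖ ≤
      ‖u‖ ^ 3 * (1 / 2 + 3 / 8 * M + 1 / 8 * M ^ 2) := by
    rw [norm_mul, norm_pow]
    gcongr
    refine (norm_add₃_le).trans ?_
    simp only [norm_mul, norm_pow, norm_div, norm_one, Complex.norm_ofNat]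
    gcongr
  have h2 : ‖1 - u‖ ≤ 1 + M := by
    refine (norm_sub_le _ _).trans ?_
    rw [norm_one]
    gcongr
  rw [hEq]
  calc _ ≤ ‖u ^ 3 * (1 / 2 + 3 / 8 * u + 1 / 8 * u ^ 2)‖ + ‖1 - u‖ * ‖R‖ := by
        refine (norm_add_le _ _).trans ?_
        rw [norm_neg, norm_mul (1 - u)]
    _ ≤ ‖u‖ ^ 3 * (1 / 2 + 3 / 8 * M + 1 / 8 * M ^ 2) +
        (1 + M) * (‖u‖ ^ 3 * ((1 + M / 2) ^ 3 * Real.exp (M * (1 + M / 2)))) := by gcongr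
    _ = _ := by ring

/-- The defining product as a product over all of `ℤ × ℤ`: at `(0, 0)` the quotient `z / 0` is `0`,
so that this additional factor is `1`. -/
theorem sigma_eq_tprod {lam : ℂ}
    (hinj : ∀ m n : ℤ, (m : ℂ) * omega₁ lam + n * omega₂ lam = 0 → m = 0 ∧ n = 0) (z : ℂ) :
    sigma lam z =
      z * ∏' p : ℤ × ℤ, elementaryFactor (z / (p.1 * omega₁ lam + p.2 * omega₂ lam)) := by
  let e : ℤ × ℤ → latticeOf lam := fun p =>
    ⟨p.1 • omega₁ lam + p.2 • omega₂ lam, Submodule.mem_span_pair.2 ⟨p.1, p.2, rfl⟩⟩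
  have he : Function.Bijective e := by
    constructor
    · intro p q hpq
      have h1 : p.1 • omega₁ lam + p.2 • omega₂ lam = q.1 • omega₁ lam + q.2 • omega₂ lam :=
        congrArg Subtype.val hpq
      simp only [zsmul_eq_mul] at h1
      have := hinj (p.1 - q.1) (p.2 - q.2) (by push_cast; linear_combination h1)
      ext <;> linarith [this.1, this.2]
    · rintro ⟨w, hw⟩
      obtain ⟨a, b, h⟩ := Submodule.mem_span_pair.1 hw
      exact ⟨(a, b), Subtype.ext h⟩
  rw [sigma, weierstrassSigma]
  congr 1
  have h1 := tprod_subtype_eq_of_mulSupport_subset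
    (f := fun w : latticeOf lam => elementaryFactor (z / (w : ℂ)))
    (s := {w : latticeOf lam | w ≠ 0}) (fun w hw h0 => hw (by simp [h0]))
  refine Eq.trans h1 ?_
  rw [← (Equiv.ofBijective e he).tprod_eq]
  simp [e]

/-- A lower bound for lattice vectors that makes the defining product of `σ` converge uniformly
in `lam`, and shows that its factors with `n ≠ 0` tend to `1` as `ω₂ → ∞`. -/
theorem le_norm_period {w₁ w₂ : ℂ} (h1 : ‖w₁ - Real.pi‖ ≤ 1 / 2) (h2 : |w₂.re| ≤ 3)
    (h3 : 9 ≤ w₂.im) (m n : ℤ) :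
    |(m : ℝ)| + w₂.im / 3 * |(n : ℝ)| ≤ ‖(m : ℂ) * w₁ + n * w₂‖ := by
  have hpi := Real.pi_gt_three
  set A : ℂ := ⟨m * Real.pi, n * w₂.im⟩ with hA
  have hdecomp : (m : ℂ) * w₁ + n * w₂ = A - (-(m * (w₁ - Real.pi)) - n * (w₂.re : ℂ)) := by
    apply Complex.ext <;> simp [hA] <;> ring
  have hAn : 2 / 3 * (3 * |(m : ℝ)| + w₂.im * |(n : ℝ)|) ≤ ‖A‖ := by
    rw [Complex.norm_def]
    apply Real.le_sqrt_of_sq_le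
    rw [Complex.normSq_apply]
    simp only [hA]
    have e1 : (m : ℝ) ^ 2 = |(m : ℝ)| ^ 2 := (sq_abs _).symm
    have e2 : (n : ℝ) ^ 2 = |(n : ℝ)| ^ 2 := (sq_abs _).symm
    have : (m : ℝ) * Real.pi * (m * Real.pi) + n * w₂.im * (n * w₂.im) =
      |(m : ℝ)| ^ 2 * Real.pi ^ 2 + |(n : ℝ)| ^ 2 * w₂.im ^ 2 := by rw [← e1, ← e2]; ring
    rw [this]
    have h9 : |(m : ℝ)| ^ 2 * 9 ≤ |(m : ℝ)| ^ 2 * Real.pi ^ 2 := by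
      gcongr
      nlinarith
    nlinarith [sq_nonneg (3 * |(m : ℝ)| - w₂.im * |(n : ℝ)|), sq_nonneg (|(m : ℝ)|),
      sq_nonneg (|(n : ℝ)| * w₂.im)]
  have hB : ‖-((m : ℂ) * (w₁ - Real.pi)) - n * (w₂.re : ℂ)‖ ≤ |(m : ℝ)| * (1 / 2) + |(n : ℝ)| * 3 := by
    refine (norm_sub_le _ _).trans ?_
    rw [norm_neg, norm_mul, norm_mul, Complex.norm_intCast, Complex.norm_intCast,
      Complex.norm_real, Real.norm_eq_abs]
    gcongr
  rw [hdecomp]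
  have := norm_sub_norm_le A (-((m : ℂ) * (w₁ - Real.pi)) - n * (w₂.re : ℂ))
  nlinarith [abs_nonneg (m : ℝ), abs_nonneg (n : ℝ),
    mul_le_mul_of_nonneg_right h3 (abs_nonneg (n : ℝ))]

theorem eventually_le_norm_period : ∀ᶠ lam in 𝓝[legendreDomain] 0, 9 ≤ (omega₂ lam).im ∧
    ∀ m n : ℤ, |(m : ℝ)| + (omega₂ lam).im / 3 * |(n : ℝ)| ≤
      ‖(m : ℂ) * omega₁ lam + n * omega₂ lam‖ := by
  have h1 : ∀ᶠ lam in 𝓝[legendreDomain] 0, ‖omega₁ lam - Real.pi‖ ≤ 1 / 2 := by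
    filter_upwards [nhdsWithin_le_nhds (tendsto_omega₁.eventually
      (Metric.closedBall_mem_nhds (Real.pi : ℂ) (show (0 : ℝ) < 1 / 2 by norm_num)))] with lam h
    rwa [← dist_eq_norm]
  filter_upwards [h1, tendsto_im_omega₂.eventually_ge_atTop 9, self_mem_nhdsWithin]
    with lam h1 h2 h3
  exact ⟨h2, le_norm_period h1 (abs_re_omega₂_le h3) h2⟩

theorem summable_norm_rpow_neg_three :
    Summable fun p : ℤ × ℤ => (max |(p.1 : ℝ)| |(p.2 : ℝ)|) ^ (-3 : ℝ) := by
  have h := EisensteinSeries.summable_one_div_norm_rpow (k := 3) (by norm_num)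
  rw [← (finTwoArrowEquiv ℤ).symm.summable_iff] at h
  refine h.congr fun p => ?_
  have : ‖![p.1, p.2]‖ = max |(p.1 : ℝ)| |(p.2 : ℝ)| := by
    rw [EisensteinSeries.norm_eq_max_natAbs]
    simp [Nat.cast_natAbs]
  rw [← this]
  simp

/-- The product of the limits of the factors, as `ω₁ → π` and `ω₂ → ∞`, is Euler's product for
the sine; the convergence factors contribute `exp (z² / 6)` because `∑ 1 / n² = π² / 6`. -/
theorem mul_tprod_elementaryFactor_pi (z : ℂ)
    (hm : Multipliable fun m : ℤ => elementaryFactor (z / (m * Real.pi))) :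
    z * ∏' m : ℤ, elementaryFactor (z / (m * Real.pi)) =
      Complex.sin z * Complex.exp (z ^ 2 / 6) := by
  have hpi : (Real.pi : ℂ) ≠ 0 := by exact_mod_cast Real.pi_ne_zero
  have h1 := hm.hasProd.nat_mul_neg.tendsto_prod_nat.comp (tendsto_add_atTop_nat 1)
  have h2 := Complex.tendsto_euler_sin_prod (z / Real.pi)
  have h3 : Tendsto (fun n : ℕ => Complex.exp ((z / Real.pi) ^ 2 *
      ∑ j ∈ Finset.range n, (1 : ℂ) / ((j : ℂ) + 1) ^ 2)) atTop
      (𝓝 (Complex.exp (z ^ 2 / 6))) := by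
    have h4 := (hasSum_nat_add_iff' 1).2 hasSum_zeta_two
    have h5 := (Complex.hasSum_ofReal.2 h4).tendsto_sum_nat
    have h6 := (h5.const_mul ((z / Real.pi) ^ 2)).cexp
    have h7 : (z / Real.pi) ^ 2 *
        ((Real.pi ^ 2 / 6 - ∑ i ∈ Finset.range 1, (1 : ℝ) / (i : ℝ) ^ 2 : ℝ) : ℂ) = z ^ 2 / 6 := by
      push_cast
      simp
      field_simp
    rw [h7] at h6
    exact h6.congr fun n => by simp
  have h8 := (h2.mul h3).congr (f₂ := fun n : ℕ => z * ∏ i ∈ Finset.range (n + 1),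
      elementaryFactor (z / (((i : ℤ) : ℂ) * Real.pi)) *
        elementaryFactor (z / (((-(i : ℤ) : ℤ) : ℂ) * Real.pi))) (fun n => by
    rw [mul_div_cancel₀ _ hpi, Finset.prod_range_succ', Finset.mul_sum, Complex.exp_sum,
      mul_assoc z, ← Finset.prod_mul_distrib]
    simp only [Nat.cast_zero, Int.cast_zero, neg_zero, zero_mul, div_zero,
      elementaryFactor_zero, mul_one]
    congr 1
    refine Finset.prod_congr rfl fun j _ => ?_
    have hj : (j : ℂ) + 1 ≠ 0 := by exact_mod_cast Nat.succ_ne_zero j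
    have h9 : z / (((-((j + 1 : ℕ) : ℤ) : ℤ) : ℂ) * Real.pi) =
        -(z / ((((j + 1 : ℕ) : ℤ) : ℂ) * Real.pi)) := by
      push_cast
      rw [← div_neg]
      ring
    rw [h9, elementaryFactor_mul_neg]
    have h10 : (z / ((((j + 1 : ℕ) : ℤ) : ℂ) * Real.pi)) ^ 2 =
        (z / Real.pi) ^ 2 / ((j : ℂ) + 1) ^ 2 := by
      push_cast
      field_simp
    rw [h10]
    congr 2
    ring)
  have h11 := tendsto_nhds_unique (h1.const_mul z) h8
  rw [mul_div_cancel₀ _ hpi] at h11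
  simpa using h11

theorem tendsto_elementaryFactor_period (z₀ : ℂ) (p : ℤ × ℤ) :
    Tendsto (fun q : ℂ × ℂ =>
        elementaryFactor (q.2 / (p.1 * omega₁ q.1 + p.2 * omega₂ q.1)) - 1)
      (𝓝[legendreDomain] 0 ×ˢ 𝓝 z₀)
      (𝓝 ((if p.2 = 0 then elementaryFactor (z₀ / (p.1 * Real.pi)) else 1) - 1)) := by
  obtain ⟨m, n⟩ := p
  refine Tendsto.sub_const ?_ 1
  have hz : Tendsto (fun q : ℂ × ℂ => q.2) (𝓝[legendreDomain] 0 ×ˢ 𝓝 z₀) (𝓝 z₀) := tendsto_snd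
  rcases eq_or_ne n 0 with rfl | hn
  · simp only [if_true, Int.cast_zero, zero_mul, add_zero]
    refine continuous_elementaryFactor.continuousAt.tendsto.comp ?_
    rcases eq_or_ne m 0 with rfl | hm
    · simpa using tendsto_const_nhds
    · have h1 : Tendsto (fun q : ℂ × ℂ => omega₁ q.1) (𝓝[legendreDomain] 0 ×ˢ 𝓝 z₀)
          (𝓝 (Real.pi : ℂ)) := (tendsto_omega₁.mono_left nhdsWithin_le_nhds).comp tendsto_fst
      refine hz.div (h1.const_mul _) (mul_ne_zero (by exact_mod_cast hm) ?_)
      exact_mod_cast Real.pi_ne_zero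
  · simp only [hn, if_false]
    rw [← elementaryFactor_zero]
    refine continuous_elementaryFactor.continuousAt.tendsto.comp ?_
    have h1 : Tendsto (fun lam => ‖(m : ℂ) * omega₁ lam + n * omega₂ lam‖)
        (𝓝[legendreDomain] 0) atTop := by
      refine tendsto_atTop_mono' _ ?_ (tendsto_im_omega₂.atTop_div_const
        (show (0 : ℝ) < 3 by norm_num))
      filter_upwards [eventually_le_norm_period] with lam h
      have hn1 : (1 : ℝ) ≤ |(n : ℝ)| := by exact_mod_cast Int.one_le_abs hn
      have := h.2 m n
      nlinarith [abs_nonneg (m : ℝ)]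
    have h2 := tendsto_inv₀_cobounded.comp (tendsto_norm_atTop_iff_cobounded.1 h1)
    have h3 := hz.mul (h2.comp (tendsto_fst (f := 𝓝[legendreDomain] 0) (g := 𝓝 z₀)))
    rw [mul_zero] at h3
    exact h3.congr fun q => (div_eq_mul_inv _ _).symm

/-- A summable bound for the factors that is uniform for `(lam, z)` near `(0, z₀)`. -/
theorem eventually_norm_elementaryFactor_period_le (z₀ : ℂ) :
    ∃ C : ℝ, ∀ᶠ q : ℂ × ℂ in 𝓝[legendreDomain] 0 ×ˢ 𝓝 z₀, ∀ p : ℤ × ℤ,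
      ‖elementaryFactor (q.2 / (p.1 * omega₁ q.1 + p.2 * omega₂ q.1)) - 1‖ ≤
        C * (max |(p.1 : ℝ)| |(p.2 : ℝ)|) ^ (-3 : ℝ) := by
  have hM : 0 ≤ ‖z₀‖ + 1 := by positivity
  obtain ⟨C, hC0, hC⟩ := exists_norm_elementaryFactor_sub_one_le hM
  refine ⟨C * (‖z₀‖ + 1) ^ 3, ?_⟩
  have hz : ∀ᶠ z in 𝓝 z₀, ‖z‖ ≤ ‖z₀‖ + 1 :=
    (continuous_norm.continuousAt.eventually_lt_const
      (show ‖z₀‖ < ‖z₀‖ + 1 by linarith)).mono fun z h => h.le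
  filter_upwards [eventually_le_norm_period.prod_mk hz] with q hq p
  obtain ⟨⟨h9, hp⟩, hz⟩ := hq
  rcases eq_or_ne p 0 with rfl | hp0
  · simp
  set w := (p.1 : ℂ) * omega₁ q.1 + p.2 * omega₂ q.1
  set N := max |(p.1 : ℝ)| |(p.2 : ℝ)| with hN
  have hN1 : 1 ≤ N := by
    have : p.1 ≠ 0 ∨ p.2 ≠ 0 := by
      by_contra! h
      exact hp0 (Prod.ext h.1 h.2)
    rcases this with h | h
    · exact le_trans (by exact_mod_cast Int.one_le_abs h) (le_max_left _ _)
    · exact le_trans (by exact_mod_cast Int.one_le_abs h) (le_max_right _ _)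
  have hw : N ≤ ‖w‖ := by
    refine le_trans ?_ (hp p.1 p.2)
    apply max_le
    · have : 0 ≤ (omega₂ q.1).im / 3 * |(p.2 : ℝ)| := mul_nonneg (by linarith) (abs_nonneg _)
      linarith
    · nlinarith [abs_nonneg (p.1 : ℝ), abs_nonneg (p.2 : ℝ)]
  have hu : ‖q.2 / w‖ ≤ (‖z₀‖ + 1) / N := by
    rw [norm_div]
    gcongr
  calc _ ≤ C * ‖q.2 / w‖ ^ 3 := hC _ (hu.trans (div_le_self hM hN1))
    _ ≤ C * ((‖z₀‖ + 1) / N) ^ 3 := by gcongr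
    _ = _ := by
      rw [Real.rpow_neg (by linarith), div_pow, div_eq_mul_inv, mul_assoc]
      norm_cast

/-- As `lam → 0`, the functions `σ_lam` converge locally uniformly to the sigma function of the
degenerate lattice `ℤ π`, which is `sin z · exp (z² / 6)`. -/
theorem tendsto_sigma (z₀ : ℂ) :
    Tendsto (fun q : ℂ × ℂ => sigma q.1 q.2) (𝓝[legendreDomain] 0 ×ˢ 𝓝 z₀)
      (𝓝 (Complex.sin z₀ * Complex.exp (z₀ ^ 2 / 6))) := by
  obtain ⟨C, hC⟩ := eventually_norm_elementaryFactor_period_le z₀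
  have hsum := summable_norm_rpow_neg_three.mul_left C
  have hlim := tendsto_elementaryFactor_period z₀
  have key := tendsto_tprod_one_add_of_dominated_convergence hsum hlim hC
  simp only [add_sub_cancel] at key
  have hinj : Function.Injective (fun m : ℤ => ((m, 0) : ℤ × ℤ)) := fun a b h => congrArg Prod.fst h
  rw [← hinj.tprod_eq] at key
  · simp only [if_true] at key
    by_cases hbot : (𝓝[legendreDomain] (0 : ℂ) ×ˢ 𝓝 z₀) = ⊥
    · rw [hbot]; exact tendsto_bot
    have : (𝓝[legendreDomain] (0 : ℂ) ×ˢ 𝓝 z₀).NeBot := ⟨hbot⟩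
    have hm : Multipliable fun m : ℤ => elementaryFactor (z₀ / (m * Real.pi)) := by
      have hb : ∀ p : ℤ × ℤ, ‖(if p.2 = 0 then elementaryFactor (z₀ / (p.1 * Real.pi)) else 1) - 1‖
          ≤ C * (max |(p.1 : ℝ)| |(p.2 : ℝ)|) ^ (-3 : ℝ) := fun p =>
        le_of_tendsto (hlim p).norm (hC.mono fun q hq => hq p)
      have h1 := (Summable.of_nonneg_of_le (fun _ => norm_nonneg _) hb hsum).comp_injective hinj
      have h2 := multipliable_one_add_of_summable
        (f := fun m : ℤ => elementaryFactor (z₀ / (m * Real.pi)) - 1)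
        (by simpa [Function.comp_def] using h1)
      simpa using h2
    rw [← mul_tprod_elementaryFactor_pi z₀ hm]
    refine ((tendsto_snd (f := 𝓝[legendreDomain] (0 : ℂ)) (g := 𝓝 z₀)).mul key).congr' ?_
    filter_upwards [eventually_le_norm_period.prod_inl (𝓝 z₀)] with q hq
    refine (sigma_eq_tprod (fun m n h => ?_) q.2).symm
    have h1 := hq.2 m n
    rw [h, norm_zero] at h1
    have h2 : 0 ≤ |(m : ℝ)| := abs_nonneg _
    have h3 : 0 ≤ |(n : ℝ)| := abs_nonneg _
    have h4 : |(n : ℝ)| = 0 := by nlinarith [hq.1]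
    have h5 : |(m : ℝ)| = 0 := by nlinarith [hq.1]
    exact ⟨by simpa using h5, by simpa using h4⟩
  · intro p hp
    by_cases h : p.2 = 0
    · exact ⟨p.1, Prod.ext rfl h.symm⟩
    · simp [h] at hp

/-- For small `lam` the parallelogram contains any given compact piece of the open half line
`{1 + i y : 0 < y}`. The coordinates are found by Cramer's rule. -/
theorem eventually_mem_fundParallelogram {y₀ : ℝ} (hy₀ : 0 < y₀) :
    ∀ᶠ q : ℂ × ℝ in 𝓝[legendreDomain] 0 ×ˢ 𝓝 y₀, (⟨1, q.2⟩ : ℂ) ∈ fundParallelogram q.1 := by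
  have hpi := Real.pi_gt_three
  have hω : Tendsto (fun q : ℂ × ℝ => omega₁ q.1) (𝓝[legendreDomain] 0 ×ˢ 𝓝 y₀)
      (𝓝 (Real.pi : ℂ)) := (tendsto_omega₁.mono_left nhdsWithin_le_nhds).comp tendsto_fst
  have ha : Tendsto (fun q : ℂ × ℝ => (omega₁ q.1).re) (𝓝[legendreDomain] 0 ×ˢ 𝓝 y₀)
      (𝓝 Real.pi) := (Complex.continuous_re.tendsto _).comp hω
  have hb : Tendsto (fun q : ℂ × ℝ => (omega₁ q.1).im) (𝓝[legendreDomain] 0 ×ˢ 𝓝 y₀)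
      (𝓝 0) := (Complex.continuous_im.tendsto _).comp hω
  have hd : Tendsto (fun q : ℂ × ℝ => (omega₂ q.1).im) (𝓝[legendreDomain] 0 ×ˢ 𝓝 y₀) atTop :=
    tendsto_im_omega₂.comp tendsto_fst
  have hy : Tendsto (fun q : ℂ × ℝ => q.2) (𝓝[legendreDomain] 0 ×ˢ 𝓝 y₀) (𝓝 y₀) := tendsto_snd
  have hc : Tendsto (fun q : ℂ × ℝ => (omega₂ q.1).re / (omega₂ q.1).im)
      (𝓝[legendreDomain] 0 ×ˢ 𝓝 y₀) (𝓝 0) := by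
    refine squeeze_zero_norm' ?_ (hd.const_div_atTop 3)
    have h1 : ∀ᶠ q : ℂ × ℝ in 𝓝[legendreDomain] 0 ×ˢ 𝓝 y₀, q.1 ∈ legendreDomain :=
      tendsto_fst.eventually self_mem_nhdsWithin
    filter_upwards [h1, hd.eventually_gt_atTop 0] with q hq h0
    rw [norm_div, Real.norm_eq_abs, Real.norm_eq_abs, abs_of_pos h0]
    gcongr
    exact abs_re_omega₂_le hq
  -- the determinant divided by `(omega₂ lam).im`
  have hdet : Tendsto (fun q : ℂ × ℝ => (omega₁ q.1).re -
      (omega₁ q.1).im * ((omega₂ q.1).re / (omega₂ q.1).im)) (𝓝[legendreDomain] 0 ×ˢ 𝓝 y₀)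
      (𝓝 Real.pi) := by
    have := ha.sub (hb.mul hc)
    simpa using this
  have hr₁ : Tendsto (fun q : ℂ × ℝ => (1 - q.2 * ((omega₂ q.1).re / (omega₂ q.1).im)) /
      ((omega₁ q.1).re - (omega₁ q.1).im * ((omega₂ q.1).re / (omega₂ q.1).im)))
      (𝓝[legendreDomain] 0 ×ˢ 𝓝 y₀) (𝓝 (1 / Real.pi)) := by
    have := ((hy.mul hc).const_sub 1).div hdet Real.pi_ne_zero
    rwa [mul_zero, sub_zero] at this
  have hr₂' : Tendsto (fun q : ℂ × ℝ => ((omega₁ q.1).re * q.2 - (omega₁ q.1).im) /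
      ((omega₁ q.1).re - (omega₁ q.1).im * ((omega₂ q.1).re / (omega₂ q.1).im)))
      (𝓝[legendreDomain] 0 ×ˢ 𝓝 y₀) (𝓝 y₀) := by
    have := ((ha.mul hy).sub hb).div hdet Real.pi_ne_zero
    rwa [sub_zero, mul_div_cancel_left₀ _ Real.pi_ne_zero] at this
  have hr₂ := hr₂'.div_atTop hd
  have hpi1 : 1 / Real.pi < 1 := by
    rw [div_lt_one Real.pi_pos]; linarith
  filter_upwards [hr₁.eventually_lt_const hpi1, hr₁.eventually_const_lt (one_div_pos.2 Real.pi_pos),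
    hr₂.eventually_lt_const one_pos, hr₂'.eventually_const_lt hy₀, hd.eventually_gt_atTop 0,
    hdet.eventually_const_lt Real.pi_pos] with q h1 h2 h3 h4 h5 h6
  refine ⟨_, ⟨h2.le, h1⟩, _, ⟨(div_pos h4 h5).le, h3⟩, ?_, ?_⟩
  · have := mul_pos h2 h2
    nlinarith [sq_nonneg ((((omega₁ q.1).re * q.2 - (omega₁ q.1).im) /
      ((omega₁ q.1).re - (omega₁ q.1).im * ((omega₂ q.1).re / (omega₂ q.1).im))) /
      (omega₂ q.1).im)]
  · have h5' := h5.ne'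
    have h6' := h6.ne'
    set a := (omega₁ q.1).re
    set b := (omega₁ q.1).im
    set c := (omega₂ q.1).re
    set d := (omega₂ q.1).im
    have h7 : a * d - b * c ≠ 0 := by
      intro h
      apply h6'
      field_simp
      linarith
    have h8 : a - b * (c / d) = (a * d - b * c) / d := by field_simp
    rw [h8]
    obtain ⟨D, hD⟩ : ∃ D, D = a * d - b * c := ⟨_, rfl⟩
    rw [← hD] at h7 ⊢
    apply Complex.ext
    · rw [Complex.add_re, Complex.re_ofReal_mul, Complex.re_ofReal_mul]
      change 1 = _ * a + _ * c
      field_simp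
      rw [hD]
      ring
    · rw [Complex.add_im, Complex.im_ofReal_mul, Complex.im_ofReal_mul]
      change q.2 = _ * b + _ * d
      field_simp
      rw [hD]
      ring

/-! ### Sign changes on a vertical line and connected components -/

/-- The real part of the limit of `σ_lam` on the line `Re z = 1`. -/
theorem re_sin_mul_exp (y : ℝ) :
    (Complex.sin ⟨1, y⟩ * Complex.exp ((⟨1, y⟩ : ℂ) ^ 2 / 6)).re =
      Real.exp ((1 - y ^ 2) / 6) * (Real.sin 1 * Real.cosh y * Real.cos (y / 3) -
        Real.cos 1 * Real.sinh y * Real.sin (y / 3)) := by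
  have hsq : (⟨1, y⟩ : ℂ) ^ 2 / 6 = ⟨(1 - y ^ 2) / 6, y / 3⟩ := by
    apply Complex.ext
    · simp [sq]
    · simp [sq]
      ring
  have hz : (⟨1, y⟩ : ℂ) = ((1 : ℝ) : ℂ) + (y : ℂ) * Complex.I := by
    apply Complex.ext <;> simp
  have hsin : Complex.sin ⟨1, y⟩ = ⟨Real.sin 1 * Real.cosh y, Real.cos 1 * Real.sinh y⟩ := by
    rw [hz, Complex.sin_add_mul_I, Complex.mk_eq_add_mul_I]
    push_cast
    ring
  rw [hsq, hsin, Complex.mul_re, Complex.exp_re, Complex.exp_im]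
  ring

/-- `sin 1 cos t - |sin t| cos 1 = sin (1 - |t|)`, and `|sinh| ≤ cosh`. -/
theorem sin_mul_cosh_mul_cos_sub_pos {t : ℝ} (ht : |t| ≤ 1 / 2) (y : ℝ) :
    0 < Real.sin 1 * Real.cosh y * Real.cos t - Real.cos 1 * Real.sinh y * Real.sin t := by
  have hpi := Real.pi_gt_three
  have h1 : 0 < Real.sin (1 - |t|) :=
    Real.sin_pos_of_pos_of_lt_pi (by linarith) (by linarith [abs_nonneg t])
  rw [Real.sin_sub, Real.cos_abs] at h1
  have h2 : |Real.sin t| ≤ Real.sin |t| := by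
    rw [Real.abs_sin_eq_sin_abs_of_abs_le_pi (by linarith)]
  have hc := Real.cosh_pos y
  have hc1 : 0 < Real.cos 1 := Real.cos_one_pos
  have h3 : |Real.sinh y| ≤ Real.cosh y := by
    rw [← Real.cosh_abs, Real.abs_sinh]
    exact (Real.sinh_lt_cosh _).le
  have h4 : Real.sinh y * Real.sin t ≤ Real.cosh y * Real.sin |t| :=
    (le_abs_self _).trans (by rw [abs_mul]; gcongr)
  nlinarith [mul_le_mul_of_nonneg_left h4 hc1.le]

/-- An open condition on the real part of the limit that holds on a compact piece of the half line
`{1 + i y : 0 < y}` is inherited there by `σ_lam` for all small `lam`. -/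
theorem eventually_forall_mem_of_isCompact {K : Set ℝ} (hK : IsCompact K) {U : Set ℝ}
    (hU : IsOpen U)
    (h : ∀ y ∈ K, 0 < y ∧
      (Complex.sin ⟨1, y⟩ * Complex.exp ((⟨1, y⟩ : ℂ) ^ 2 / 6)).re ∈ U) :
    ∀ᶠ lam in 𝓝[legendreDomain] 0, ∀ y ∈ K, (⟨1, y⟩ : ℂ) ∈ fundParallelogram lam ∧
      (sigma lam ⟨1, y⟩).re ∈ U := by
  have key : ∀ᶠ q : ℂ × ℝ in 𝓝[legendreDomain] 0 ×ˢ 𝓝ˢ K,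
      (⟨1, q.2⟩ : ℂ) ∈ fundParallelogram q.1 ∧ (sigma q.1 ⟨1, q.2⟩).re ∈ U := by
    rw [hK.prod_nhdsSet_eq_biSup]
    simp only [eventually_iSup]
    intro y hy
    obtain ⟨hy0, hyU⟩ := h y hy
    refine (eventually_mem_fundParallelogram hy0).and ?_
    have hcont : Continuous fun y : ℝ => (⟨1, y⟩ : ℂ) := by
      have : (fun y : ℝ => (⟨1, y⟩ : ℂ)) = fun y : ℝ => 1 + (y : ℂ) * Complex.I := by
        funext y
        apply Complex.ext <;> simp
      rw [this]
      fun_prop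
    have h1 := (tendsto_sigma ⟨1, y⟩).comp
      ((tendsto_id (x := 𝓝[legendreDomain] (0 : ℂ))).prodMap (hcont.tendsto y))
    exact ((Complex.continuous_re.tendsto _).comp h1).eventually (hU.mem_nhds hyU)
  filter_upwards [key.curry] with lam hlam y hy
  exact hlam.self_of_nhdsSet y hy

/-- Near `y = 6 π (j + 1)` the angle `y / 3` is within `1 / 2` of a multiple of `2 π`. -/
theorem eventually_re_sigma_pos (j : ℕ) : ∀ᶠ lam in 𝓝[legendreDomain] 0,
    ∀ y ∈ Icc (6 * Real.pi * (j + 1) - 3 / 2) (6 * Real.pi * (j + 1) + 3 / 2),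
      (⟨1, y⟩ : ℂ) ∈ fundParallelogram lam ∧ 0 < (sigma lam ⟨1, y⟩).re := by
  refine eventually_forall_mem_of_isCompact (U := Ioi 0) isCompact_Icc isOpen_Ioi fun y hy => ⟨?_, ?_⟩
  · have hpi := Real.pi_gt_three
    have : (0 : ℝ) ≤ j := j.cast_nonneg
    nlinarith [hy.1]
  · set t := y / 3 - 2 * Real.pi * (j + 1) with ht
    have hy3 : y / 3 = t + ((j + 1 : ℕ) : ℝ) * (2 * Real.pi) := by rw [ht]; push_cast; ring
    have habs : |t| ≤ 1 / 2 := by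
      rw [abs_le]
      constructor <;> linarith [hy.1, hy.2]
    rw [mem_Ioi, re_sin_mul_exp, hy3, Real.cos_add_nat_mul_two_pi, Real.sin_add_nat_mul_two_pi]
    exact mul_pos (Real.exp_pos _) (sin_mul_cosh_mul_cos_sub_pos habs y)

theorem eventually_re_sigma_neg (j : ℕ) : ∀ᶠ lam in 𝓝[legendreDomain] 0,
    ∀ y ∈ Icc (6 * Real.pi * (j + 1) + 3 * Real.pi - 3 / 2)
        (6 * Real.pi * (j + 1) + 3 * Real.pi + 3 / 2),
      (⟨1, y⟩ : ℂ) ∈ fundParallelogram lam ∧ (sigma lam ⟨1, y⟩).re < 0 := by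
  refine eventually_forall_mem_of_isCompact (U := Iio 0) isCompact_Icc isOpen_Iio fun y hy => ⟨?_, ?_⟩
  · have hpi := Real.pi_gt_three
    have : (0 : ℝ) ≤ j := j.cast_nonneg
    nlinarith [hy.1]
  · set t := y / 3 - (2 * Real.pi * (j + 1) + Real.pi) with ht
    have hy3 : y / 3 = t + Real.pi + ((j + 1 : ℕ) : ℝ) * (2 * Real.pi) := by
      rw [ht]; push_cast; ring
    have habs : |t| ≤ 1 / 2 := by
      rw [abs_le]
      constructor <;> linarith [hy.1, hy.2]
    rw [mem_Iio, re_sin_mul_exp, hy3, Real.cos_add_nat_mul_two_pi, Real.sin_add_nat_mul_two_pi,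
      Real.cos_add_pi, Real.sin_add_pi]
    have h1 := mul_pos (Real.exp_pos ((1 - y ^ 2) / 6)) (sin_mul_cosh_mul_cos_sub_pos habs y)
    linarith

/-- Points `a i` of `A` and points `c i` outside of `A` that alternate on the line separate the
components of the `a i`. -/
theorem natCast_le_card_connectedComponents {A : Set ℝ} {n : ℕ} (a c : ℕ → ℝ)
    (hac : ∀ i, a i < c i) (hca : ∀ i, c i < a (i + 1)) (ha : ∀ i < n, a i ∈ A)
    (hc : ∀ i < n, c i ∉ A) : (n : ℕ∞) ≤ ENat.card (ConnectedComponents A) := by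
  have hmono : StrictMono a := strictMono_nat_of_lt_succ fun i => (hac i).trans (hca i)
  have hsep : ∀ i j : Fin n, i < j →
      (⟨a i, ha i i.2⟩ : A) ∉ connectedComponent (⟨a j, ha j j.2⟩ : A) := by
    intro i j hij hmem
    have hconn : IsPreconnected (Subtype.val '' connectedComponent (⟨a j, ha j j.2⟩ : A)) :=
      isPreconnected_connectedComponent.image _ continuous_subtype_val.continuousOn
    have hj : a j ∈ Subtype.val '' connectedComponent (⟨a j, ha j j.2⟩ : A) :=
      ⟨_, mem_connectedComponent, rfl⟩
    have hi : a i ∈ Subtype.val '' connectedComponent (⟨a j, ha j j.2⟩ : A) := ⟨_, hmem, rfl⟩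
    have hle : a (i + 1) ≤ a j := hmono.monotone (Nat.succ_le_of_lt hij)
    obtain ⟨x, -, hx⟩ := hconn.ordConnected.out hi hj ⟨(hac i).le, ((hca i).trans_le hle).le⟩
    exact hc i i.2 (hx ▸ x.2)
  have hinj : Function.Injective
      fun i : Fin n => (ConnectedComponents.mk (⟨a i, ha i i.2⟩ : A)) := by
    intro i j hij
    have h : connectedComponent (⟨a i, ha i i.2⟩ : A) = connectedComponent ⟨a j, ha j j.2⟩ :=
      ConnectedComponents.coe_eq_coe.1 hij
    rcases lt_trichotomy i j with h1 | h1 | h1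
    · exact (hsep i j h1 (h ▸ mem_connectedComponent)).elim
    · exact h1
    · exact (hsep j i h1 (h ▸ mem_connectedComponent)).elim
  simpa using ENat.card_le_card_of_injective hinj

/-- The formula `¬ f (1, x) ≤ 0`. -/
def signFormula : fieldTwoLang.Formula (Fin 1) :=
  let zero : fieldTwoLang.Term (Fin 1) :=
    Language.Term.func (l := 0) (Sum.inl (Sum.inl Ring.zeroFunc)) Fin.elim0
  let one : fieldTwoLang.Term (Fin 1) :=
    Language.Term.func (l := 0) (Sum.inl (Sum.inl Ring.oneFunc)) Fin.elim0
  let value : fieldTwoLang.Term (Fin 1) :=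
    Language.Term.func (l := 2) (Sum.inr TwoFunc.f) ![one, Language.Term.var 0]
  (Language.Relations.formula (n := 2) (L := fieldTwoLang)
    (Sum.inl (Sum.inr Language.leSymb)) ![value, zero]).not

theorem mem_definedSet_signFormula (h : ℂ → ℂ) (x : ℝ) :
    x ∈ definedSet signFormula h ↔ 0 < (h ⟨1, x⟩).re := by
  rw [← not_le]
  rfl

theorem exists_formula_forall_le_card_connectedComponents :
    ∃ θ : fieldTwoLang.Formula (Fin 1), ∀ n : ℕ, ∃ ε : ℝ, 0 < ε ∧
      ∀ lam ∈ legendreDomain, ‖lam‖ < ε →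
        (n : ℕ∞) ≤ ENat.card (ConnectedComponents (definedSet θ
          ((fundParallelogram lam).indicator (sigma lam)))) ∧
        (n : ℕ∞) ≤ ENat.card (ConnectedComponents (definedSet θ (sigma lam))) := by
  refine ⟨signFormula, fun n => ?_⟩
  have hev : ∀ᶠ lam in 𝓝[legendreDomain] 0, ∀ j < n,
      ((⟨1, 6 * Real.pi * (j + 1)⟩ : ℂ) ∈ fundParallelogram lam ∧
        0 < (sigma lam ⟨1, 6 * Real.pi * (j + 1)⟩).re) ∧
      ((⟨1, 6 * Real.pi * (j + 1) + 3 * Real.pi⟩ : ℂ) ∈ fundParallelogram lam ∧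
        (sigma lam ⟨1, 6 * Real.pi * (j + 1) + 3 * Real.pi⟩).re < 0) := by
    refine (finite_lt_nat n).eventually_all.2 fun j _ => ?_
    filter_upwards [eventually_re_sigma_pos j, eventually_re_sigma_neg j] with lam h1 h2
    exact ⟨h1 _ ⟨by linarith, by linarith⟩, h2 _ ⟨by linarith, by linarith⟩⟩
  obtain ⟨ε, hε, hball⟩ := Metric.mem_nhdsWithin_iff.1 hev
  refine ⟨ε, hε, fun lam hlam hlt => ?_⟩
  have h := hball ⟨by simpa using hlt, hlam⟩
  have hpi := Real.pi_pos
  constructor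
  all_goals
    refine natCast_le_card_connectedComponents (fun j : ℕ => 6 * Real.pi * (j + 1))
      (fun j : ℕ => 6 * Real.pi * (j + 1) + 3 * Real.pi) (fun i => by linarith)
      (fun i => by push_cast; nlinarith) (fun i hi => ?_) (fun i hi => ?_)
    all_goals
      rw [mem_definedSet_signFormula]
      obtain ⟨⟨h1, h2⟩, h3, h4⟩ := h i hi
  · rwa [indicator_of_mem h1]
  · rw [indicator_of_mem h3]
    exact h4.not_gt
  · exact h2
  · exact h4.not_gt

/-! ### Definable choice in o-minimal expansions of the real field -/

variable {L : FirstOrder.Language.{u, v}} [L.Structure ℝ] {α β : Type}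

variable (L) in
/-- The predicate `P` on tuples of real numbers indexed by `α` is definable with parameters. -/
def DefPred (P : (α → ℝ) → Prop) : Prop := (univ : Set ℝ).Definable L {v | P v}

variable (L) in
/-- The real-valued function `f` of tuples indexed by `α` has a definable graph. The value is
stored in the coordinate `none`. -/
def DefTerm (f : (α → ℝ) → ℝ) : Prop :=
  DefPred L fun v : Option α → ℝ => v none = f fun a => v (some a)

namespace DefPred

theorem congr {P Q : (α → ℝ) → Prop} (h : DefPred L P) (hPQ : ∀ v, Q v ↔ P v) :
    DefPred L Q := by
  have : Q = P := funext fun v => propext (hPQ v)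
  rwa [this]

theorem and {P Q : (α → ℝ) → Prop} (hP : DefPred L P) (hQ : DefPred L Q) :
    DefPred L fun v => P v ∧ Q v :=
  Set.Definable.inter hP hQ

theorem not {P : (α → ℝ) → Prop} (hP : DefPred L P) : DefPred L fun v => ¬ P v :=
  Set.Definable.compl hP

theorem imp {P Q : (α → ℝ) → Prop} (hP : DefPred L P) (hQ : DefPred L Q) :
    DefPred L fun v => P v → Q v :=
  (hP.and hQ.not).not.congr fun v => by tauto

theorem comap {P : (α → ℝ) → Prop} (hP : DefPred L P) (f : α → β) :
    DefPred L fun v : β → ℝ => P fun a => v (f a) :=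
  Set.Definable.preimage_comp f hP

theorem exists_tuple {ι : Type} [Finite ι] {P : (α → ℝ) → (ι → ℝ) → Prop}
    (hP : DefPred L fun v : α ⊕ ι → ℝ => P (fun a => v (Sum.inl a)) fun i => v (Sum.inr i)) :
    DefPred L fun v => ∃ b, P v b :=
  Set.Definable.exists_of_finite hP

theorem ex {P : (α → ℝ) → ℝ → Prop}
    (hP : DefPred L fun v : Option α → ℝ => P (fun a => v (some a)) (v none)) :
    DefPred L fun v => ∃ x, P v x := by
  have h := hP.comap (fun o : Option α => (o.elim (Sum.inr ()) Sum.inl : α ⊕ Unit))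
  refine (exists_tuple (ι := Unit) (P := fun v b => P v (b ())) h).congr fun v => ?_
  exact ⟨fun ⟨x, hx⟩ => ⟨fun _ => x, hx⟩, fun ⟨b, hb⟩ => ⟨b (), hb⟩⟩

theorem all {P : (α → ℝ) → ℝ → Prop}
    (hP : DefPred L fun v : Option α → ℝ => P (fun a => v (some a)) (v none)) :
    DefPred L fun v => ∀ x, P v x :=
  (ex (P := fun v x => ¬ P v x) hP.not).not.congr fun v => by simp

/-- Substitution of variables in a family of predicates. -/
theorem subst {P : (α → ℝ) → ℝ → Prop}
    (hP : DefPred L fun v : Option α → ℝ => P (fun a => v (some a)) (v none))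
    (f : α → β) (i : β) : DefPred L fun v : β → ℝ => P (fun a => v (f a)) (v i) :=
  hP.comap fun o : Option α => o.elim i f

end DefPred

theorem defTerm_const (c : ℝ) : DefTerm L fun _ : α → ℝ => c := by
  have h : DefPred L fun v : Fin 1 → ℝ => v 0 = c :=
    Set.Definable.singleton_of_mem L (mem_univ c)
  exact h.comap fun _ => none

theorem defTerm_var (i : α) : DefTerm L fun v : α → ℝ => v i := by
  have h : DefPred L fun v : Fin 2 → ℝ => v 0 = v 1 := Set.Definable.diagonal L univ
  exact h.comap ![none, some i]

namespace IsOMinimalRealField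

theorem defTerm_add (h : IsOMinimalRealField L) {f g : (α → ℝ) → ℝ} (hf : DefTerm L f)
    (hg : DefTerm L g) : DefTerm L fun v => f v + g v := by
  have hadd : DefPred L fun v : Fin 3 → ℝ => v 0 + v 1 = v 2 := h.definable_add
  have h1 : DefPred L fun v : Option α → ℝ => ∃ x, ∃ y,
      (x = f (fun a => v (some a)) ∧ y = g fun a => v (some a)) ∧ x + y = v none :=
    .ex <| .ex <| .and (.and
      (hf.comap fun o : Option α => o.elim (some none) fun a => some (some (some a)))
      (hg.comap fun o : Option α => o.elim none fun a => some (some (some a))))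
      (hadd.comap ![some none, none, some (some none)])
  exact h1.congr fun v => ⟨fun hv => ⟨_, _, ⟨rfl, rfl⟩, hv.symm⟩,
    fun ⟨x, y, ⟨hx, hy⟩, hxy⟩ => by rw [← hxy, hx, hy]⟩

theorem defPred_le (h : IsOMinimalRealField L) {f g : (α → ℝ) → ℝ} (hf : DefTerm L f)
    (hg : DefTerm L g) : DefPred L fun v => f v ≤ g v := by
  have hle : DefPred L fun v : Fin 2 → ℝ => v 0 ≤ v 1 := h.definable_le
  have h1 : DefPred L fun v : α → ℝ => ∃ x, ∃ y, (x = f v ∧ y = g v) ∧ x ≤ y :=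
    .ex <| .ex <| .and (.and
      (hf.comap fun o : Option α => o.elim (some none) fun a => some (some a))
      (hg.comap fun o : Option α => o.elim none fun a => some (some a)))
      (hle.comap ![some none, none])
  exact h1.congr fun v => ⟨fun hv => ⟨_, _, ⟨rfl, rfl⟩, hv⟩,
    fun ⟨x, y, ⟨hx, hy⟩, hxy⟩ => by rwa [← hx, ← hy]⟩

theorem defPred_lt (h : IsOMinimalRealField L) {f g : (α → ℝ) → ℝ} (hf : DefTerm L f)
    (hg : DefTerm L g) : DefPred L fun v => f v < g v :=
  (h.defPred_le hg hf).not.congr fun _ => not_le.symm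

theorem defPred_eq (h : IsOMinimalRealField L) {f g : (α → ℝ) → ℝ} (hf : DefTerm L f)
    (hg : DefTerm L g) : DefPred L fun v => f v = g v :=
  ((h.defPred_le hf hg).and (h.defPred_le hg hf)).congr fun _ => le_antisymm_iff

theorem defPred_isGLB (h : IsOMinimalRealField L) {P : (α → ℝ) → ℝ → Prop}
    (hP : DefPred L fun v : Option α → ℝ => P (fun a => v (some a)) (v none)) (i : α) :
    DefPred L fun v => IsGLB {x | P v x} (v i) := by
  have h1 : DefPred L fun v : α → ℝ => (∀ x, P v x → v i ≤ x) ∧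
      ∀ y, (∀ x, P v x → y ≤ x) → y ≤ v i :=
    .and (.all (.imp hP (h.defPred_le (defTerm_var _) (defTerm_var _))))
      (.all (.imp (.all (.imp (hP.subst (fun a => some (some a)) none)
        (h.defPred_le (defTerm_var _) (defTerm_var _))))
        (h.defPred_le (defTerm_var _) (defTerm_var _))))
  exact h1

theorem defPred_isLUB (h : IsOMinimalRealField L) {P : (α → ℝ) → ℝ → Prop}
    (hP : DefPred L fun v : Option α → ℝ => P (fun a => v (some a)) (v none)) (i : α) :
    DefPred L fun v => IsLUB {x | P v x} (v i) := by
  have h1 : DefPred L fun v : α → ℝ => (∀ x, P v x → x ≤ v i) ∧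
      ∀ y, (∀ x, P v x → x ≤ y) → v i ≤ y :=
    .and (.all (.imp hP (h.defPred_le (defTerm_var _) (defTerm_var _))))
      (.all (.imp (.all (.imp (hP.subst (fun a => some (some a)) none)
        (h.defPred_le (defTerm_var _) (defTerm_var _))))
        (h.defPred_le (defTerm_var _) (defTerm_var _))))
  exact h1

end IsOMinimalRealField

/-- The leftmost convex component of `X ∩ [-(R + 1), R + 1]`, provided that there is one. -/
def leftPiece (X : Set ℝ) (R : ℝ) : Set ℝ :=
  {c | (c ∈ X ∧ 0 ≤ c + (R + 1) ∧ c ≤ R + 1) ∧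
    ∀ d, d ∈ X → 0 ≤ d + (R + 1) → d ≤ c → ∀ e, d ≤ e → e ≤ c → e ∈ X}

/-- `c` is the canonical element of `X`: with `R` the distance of `X` from `0`, the midpoint of the
leftmost convex component of `X ∩ [-(R + 1), R + 1]`. -/
def IsCanonical (X : Set ℝ) (c : ℝ) : Prop :=
  ∃ R a s, IsGLB {r | ∃ x, x ∈ X ∧ 0 ≤ x + r ∧ x ≤ r} R ∧ IsGLB {x | x ∈ leftPiece X R} a ∧
    IsLUB {x | x ∈ leftPiece X R} s ∧ c + c = a + s

theorem IsCanonical.unique {X : Set ℝ} {c c' : ℝ} (h : IsCanonical X c) (h' : IsCanonical X c') :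
    c = c' := by
  obtain ⟨R, a, s, hR, ha, hs, h⟩ := h
  obtain ⟨R', a', s', hR', ha', hs', h'⟩ := h'
  obtain rfl := hR.unique hR'
  obtain rfl := ha.unique ha'
  obtain rfl := hs.unique hs'
  linarith

/-- If a finite union of convex sets meets `[l, r]`, its intersection with `[l, r]` has a leftmost
convex component: choose one point of each piece and take the smallest of these points. -/
theorem exists_leftmost {X : Set ℝ} {C : Set (Set ℝ)} (hC : C.Finite)
    (hconv : ∀ I ∈ C, I.OrdConnected) (hX : X = ⋃₀ C) {l r x₀ : ℝ} (hx₀ : x₀ ∈ X) (hl : l ≤ x₀)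
    (hr : x₀ ≤ r) : ∃ c ∈ X, l ≤ c ∧ c ≤ r ∧
      ∀ d ∈ X, l ≤ d → d ≤ c → ∀ e, d ≤ e → e ≤ c → e ∈ X := by
  let D : Set (Set ℝ) := {I ∈ C | ∃ x ∈ I, l ≤ x ∧ x ≤ r}
  have hD : D.Finite := hC.subset fun I hI => hI.1
  have hex : ∀ I ∈ D, ∃ x ∈ I, l ≤ x ∧ x ≤ r := fun I hI => hI.2
  choose! p hpI hpl hpr using hex
  obtain ⟨I₀, hI₀C, hxI₀⟩ := mem_sUnion.1 (hX ▸ hx₀)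
  have hDne : D.Nonempty := ⟨I₀, hI₀C, x₀, hxI₀, hl, hr⟩
  obtain ⟨J, hJ, hmin⟩ := exists_min_image D p hD hDne
  refine ⟨p J, ?_, hpl J hJ, hpr J hJ, fun d hd hld hdc e hde hec => ?_⟩
  · rw [hX]
    exact ⟨J, hJ.1, hpI J hJ⟩
  · rw [hX] at hd ⊢
    obtain ⟨I, hIC, hdI⟩ := hd
    have hI : I ∈ D := ⟨hIC, d, hdI, hld, hdc.trans (hpr J hJ)⟩
    exact ⟨I, hIC, (hconv I hIC).out hdI (hpI I hI) ⟨hde, hec.trans (hmin I hI)⟩⟩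

theorem exists_isCanonical {X : Set ℝ} {C : Set (Set ℝ)} (hC : C.Finite)
    (hconv : ∀ I ∈ C, I.OrdConnected) (hX : X = ⋃₀ C) (hne : X.Nonempty) :
    ∃ c ∈ X, IsCanonical X c := by
  obtain ⟨x₁, hx₁⟩ := hne
  have hRbdd : BddBelow {r : ℝ | ∃ x, x ∈ X ∧ 0 ≤ x + r ∧ x ≤ r} :=
    ⟨0, fun r ⟨x, _, h1, h2⟩ => by linarith⟩
  have hRne : {r : ℝ | ∃ x, x ∈ X ∧ 0 ≤ x + r ∧ x ≤ r}.Nonempty :=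
    ⟨|x₁|, x₁, hx₁, by linarith [neg_abs_le x₁], le_abs_self x₁⟩
  obtain ⟨R, hR⟩ : ∃ R, IsGLB {r : ℝ | ∃ x, x ∈ X ∧ 0 ≤ x + r ∧ x ≤ r} R :=
    ⟨_, isGLB_csInf hRne hRbdd⟩
  obtain ⟨r, ⟨x₀, hx₀, h1, h2⟩, -, hr⟩ := hR.exists_between (show R < R + 1 by linarith)
  obtain ⟨q, hqX, hq1, hq2, hq3⟩ := exists_leftmost hC hconv hX hx₀
    (show -(R + 1) ≤ x₀ by linarith) (show x₀ ≤ R + 1 by linarith)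
  have hqJ : q ∈ leftPiece X R :=
    ⟨⟨hqX, by linarith, hq2⟩, fun d hd h0 hdc => hq3 d hd (by linarith) hdc⟩
  have hbelow : BddBelow {x | x ∈ leftPiece X R} := ⟨-(R + 1), fun x hx => by linarith [hx.1.2.1]⟩
  have habove : BddAbove {x | x ∈ leftPiece X R} := ⟨R + 1, fun x hx => hx.1.2.2⟩
  have ha := isGLB_csInf ⟨q, hqJ⟩ hbelow
  have hs := isLUB_csSup ⟨q, hqJ⟩ habove
  set a := sInf {x | x ∈ leftPiece X R}
  set s := sSup {x | x ∈ leftPiece X R}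
  refine ⟨(a + s) / 2, ?_, R, a, s, hR, ha, hs, by ring⟩
  have haq : a ≤ q := ha.1 hqJ
  have hqs : q ≤ s := hs.1 hqJ
  rcases (haq.trans hqs).eq_or_lt with h | h
  · have : (a + s) / 2 = q := by linarith
    rwa [this]
  · obtain ⟨j, hj, -, hj1⟩ := ha.exists_between (show a < (a + s) / 2 by linarith)
    obtain ⟨j', hj', hj1', -⟩ := hs.exists_between (show (a + s) / 2 < s by linarith)
    exact hj'.2 j hj.1.1 hj.1.2.1 (by linarith) _ hj1.le hj1'.le

namespace IsOMinimalRealField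

theorem finite_union_fiber (h : IsOMinimalRealField L) {P : (α → ℝ) → ℝ → Prop}
    (hP : DefPred L fun v : Option α → ℝ => P (fun a => v (some a)) (v none)) [Finite α]
    (v : α → ℝ) :
    ∃ C : Set (Set ℝ), C.Finite ∧ (∀ I ∈ C, I.OrdConnected) ∧ {x | P v x} = ⋃₀ C := by
  refine h.finite_union _ ?_
  have hconst : DefPred L fun w : α → ℝ => ∀ a, w a = v a := by
    have := Set.definable_iInter_of_finite (A := (univ : Set ℝ)) (L := L)
      (f := fun a : α => {w : α → ℝ | w a = v a})
      fun a => h.defPred_eq (defTerm_var a) (defTerm_const (v a))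
    have h2 : {w : α → ℝ | ∀ a, w a = v a} = ⋂ a, {w : α → ℝ | w a = v a} := by
      ext w; simp
    rw [DefPred, h2]
    exact this
  have h1 : DefPred L fun x : Fin 1 → ℝ => ∃ w : α → ℝ, (∀ a, w a = v a) ∧ P w (x 0) :=
    .exists_tuple (.and (hconst.comap Sum.inr) (hP.subst Sum.inr (Sum.inl 0)))
  refine h1.congr fun x => ⟨fun hx => ⟨v, fun _ => rfl, hx⟩, fun ⟨w, hw, hx⟩ => ?_⟩
  obtain rfl : w = v := funext hw
  exact hx

theorem defPred_isCanonical (h : IsOMinimalRealField L) {P : (α → ℝ) → ℝ → Prop}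
    (hP : DefPred L fun v : Option α → ℝ => P (fun a => v (some a)) (v none)) :
    DefPred L fun v : Option α → ℝ => IsCanonical {x | P (fun a => v (some a)) x} (v none) := by
  have hradius : DefPred L fun v : Option α → ℝ =>
      IsGLB {r | ∃ x, P (fun a => v (some a)) x ∧ 0 ≤ x + r ∧ x ≤ r} (v none) :=
    h.defPred_isGLB (P := fun v r => ∃ x, P (fun a => v (some a)) x ∧ 0 ≤ x + r ∧ x ≤ r)
      (.ex (.and (hP.subst (fun a => some (some (some a))) none)
        (.and (h.defPred_le (defTerm_const _) (h.defTerm_add (defTerm_var _) (defTerm_var _)))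
          (h.defPred_le (defTerm_var _) (defTerm_var _))))) none
  have hpiece : DefPred L fun v : Option (Option α) → ℝ =>
      v none ∈ leftPiece {x | P (fun a => v (some (some a))) x} (v (some none)) := by
    refine .and (.and (hP.subst (fun a => some (some a)) none) (.and ?_ ?_)) (.all (.imp
      (hP.subst (fun a => some (some (some a))) none) (.imp ?_ (.imp ?_ (.all (.imp ?_
        (.imp ?_ (hP.subst (fun a => some (some (some (some a)))) none))))))))
    · exact h.defPred_le (defTerm_const _)
        (h.defTerm_add (defTerm_var _) (h.defTerm_add (defTerm_var _) (defTerm_const _)))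
    · exact h.defPred_le (defTerm_var _) (h.defTerm_add (defTerm_var _) (defTerm_const _))
    · exact h.defPred_le (defTerm_const _)
        (h.defTerm_add (defTerm_var _) (h.defTerm_add (defTerm_var _) (defTerm_const _)))
    all_goals exact h.defPred_le (defTerm_var _) (defTerm_var _)
  -- the coordinates are the tuple, the element `c`, and then `R`, `a`, `s`
  refine .ex <| .ex <| .ex <| .and ?_ <| .and ?_ <| .and ?_ ?_
  · exact hradius.comap fun o : Option α =>
      o.elim (some (some none)) fun a => some (some (some (some a)))
  · exact h.defPred_isGLB (P := fun (v : Option (Option (Option (Option α))) → ℝ) x =>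
      x ∈ leftPiece {x | P (fun a => v (some (some (some (some a))))) x} (v (some (some none))))
      (hpiece.comap fun o : Option (Option α) => o.elim none fun o => o.elim
        (some (some (some none))) fun a => some (some (some (some (some a))))) (some none)
  · exact h.defPred_isLUB (P := fun (v : Option (Option (Option (Option α))) → ℝ) x =>
      x ∈ leftPiece {x | P (fun a => v (some (some (some (some a))))) x} (v (some (some none))))
      (hpiece.comap fun o : Option (Option α) => o.elim none fun o => o.elim
        (some (some (some none))) fun a => some (some (some (some (some a))))) none
  · exact h.defPred_eq (h.defTerm_add (defTerm_var _) (defTerm_var _))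
      (h.defTerm_add (defTerm_var _) (defTerm_var _))

/-- Definable choice: a definable family of subsets of `ℝᵏ` has a definable partial selector. -/
theorem exists_definable_choice (h : IsOMinimalRealField L) (k : ℕ) {α : Type} [Finite α]
    {P : (α → ℝ) → (Fin k → ℝ) → Prop}
    (hP : DefPred L fun v : α ⊕ Fin k → ℝ => P (fun a => v (Sum.inl a)) fun i => v (Sum.inr i)) :
    ∃ Q : (α → ℝ) → (Fin k → ℝ) → Prop,
      (DefPred L fun v : α ⊕ Fin k → ℝ => Q (fun a => v (Sum.inl a)) fun i => v (Sum.inr i)) ∧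
      (∀ v b, Q v b → P v b) ∧ (∀ v b b', Q v b → Q v b' → b = b') ∧
      ∀ v, (∃ b, P v b) → ∃ b, Q v b := by
  induction k generalizing α with
  | zero => exact ⟨P, hP, fun _ _ => id, fun _ _ _ _ _ => Subsingleton.elim _ _, fun _ => id⟩
  | succ k ih =>
    let P₂ : (Option α → ℝ) → (Fin k → ℝ) → Prop :=
      fun w b => P (fun a => w (some a)) (Fin.cons (w none) b)
    have hP₂ : DefPred L fun v : Option α ⊕ Fin k → ℝ =>
        P₂ (fun a => v (Sum.inl a)) fun i => v (Sum.inr i) := by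
      refine (hP.comap (Sum.elim (fun a => Sum.inl (some a))
        (Fin.cons (Sum.inl none) fun i => Sum.inr i) :
          α ⊕ Fin (k + 1) → Option α ⊕ Fin k)).congr fun v => ?_
      have : (Fin.cons (v (Sum.inl none)) fun i => v (Sum.inr i) : Fin (k + 1) → ℝ) =
          fun i => v ((Fin.cons (Sum.inl none) fun i => Sum.inr i :
            Fin (k + 1) → Option α ⊕ Fin k) i) := by
        funext i
        refine Fin.cases rfl (fun i => rfl) i
      simp only [P₂, this, Sum.elim_inl, Sum.elim_inr]
    have hP₁ : DefPred L fun w : Option α → ℝ => ∃ b, P₂ w b := .exists_tuple hP₂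
    obtain ⟨Q₂, hQ₂, hQP₂, huniq, hex⟩ := ih hP₂
    let X : (α → ℝ) → ℝ → Prop := fun v x => ∃ b, P₂ (fun o => o.elim x v) b
    have hX : DefPred L fun w : Option α → ℝ => X (fun a => w (some a)) (w none) := by
      refine hP₁.congr fun w => ?_
      have : (fun o : Option α => o.elim (w none) fun a => w (some a)) = w := by
        funext o; cases o <;> rfl
      simp only [X, this]
    have hcan := h.defPred_isCanonical hX
    refine ⟨fun v b => IsCanonical {x | X v x} (b 0) ∧
      Q₂ (fun o => o.elim (b 0) v) fun i => b i.succ, ?_, ?_, ?_, ?_⟩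
    · refine .and (hcan.comap fun o : Option α => o.elim (Sum.inr 0) Sum.inl) ?_
      refine (hQ₂.comap (Sum.elim (fun o => o.elim (Sum.inr 0) Sum.inl) (fun i => Sum.inr i.succ) :
        Option α ⊕ Fin k → α ⊕ Fin (k + 1))).congr fun v => ?_
      have : (fun o : Option α => o.elim (v (Sum.inr 0)) fun a => v (Sum.inl a)) =
          fun o => v (o.elim (Sum.inr 0) Sum.inl) := by
        funext o; cases o <;> rfl
      simp only [this, Sum.elim_inl, Sum.elim_inr]
    · rintro v b ⟨-, hb⟩
      have := hQP₂ _ _ hb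
      simp only [P₂, Option.elim] at this
      convert! this using 1
      funext i
      refine Fin.cases rfl (fun i => rfl) i
    · rintro v b b' ⟨h1, h2⟩ ⟨h1', h2'⟩
      have h0 : b 0 = b' 0 := h1.unique h1'
      rw [← h0] at h2'
      have hs := huniq _ _ _ h2 h2'
      funext i
      refine Fin.cases h0 (fun i => congrFun hs i) i
    · rintro v ⟨b, hb⟩
      have hne : {x | X v x}.Nonempty := by
        refine ⟨b 0, fun i => b i.succ, ?_⟩
        simp only [P₂, Option.elim]
        convert! hb using 1
        funext i
        refine Fin.cases rfl (fun i => rfl) i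
      obtain ⟨C, hC, hconv, hXC⟩ := h.finite_union_fiber hX v
      obtain ⟨c, hcX, hc⟩ := exists_isCanonical hC hconv hXC hne
      obtain ⟨b', hb'⟩ := hex (fun o => o.elim c v) hcX
      exact ⟨Fin.cons c b', hc, hb'⟩

/-- Dichotomy at infinity: a definable predicate of one real variable is eventually true or
eventually false. -/
theorem eventually_or_eventually_not (h : IsOMinimalRealField L) {P : ℝ → Prop}
    (hP : DefPred L fun v : Fin 1 → ℝ => P (v 0)) :
    (∀ᶠ x in atTop, P x) ∨ ∀ᶠ x in atTop, ¬ P x := by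
  obtain ⟨C, hC, hconv, hPC⟩ := h.finite_union {x | P x} hP
  by_cases hbdd : BddAbove {x | P x}
  · right
    obtain ⟨M, hM⟩ := hbdd
    filter_upwards [eventually_gt_atTop M] with x hx hPx
    exact hx.not_ge (hM hPx)
  · left
    rw [hPC, sUnion_eq_biUnion, hC.bddAbove_biUnion] at hbdd
    push Not at hbdd
    obtain ⟨I, hI, hIb⟩ := hbdd
    rw [not_bddAbove_iff] at hIb
    obtain ⟨x₀, hx₀, -⟩ := hIb 0
    filter_upwards [eventually_ge_atTop x₀] with x hx
    obtain ⟨x₁, hx₁, hlt⟩ := hIb x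
    have hxI : x ∈ I := (hconv I hI).out hx₀ hx₁ ⟨hx, hlt.le⟩
    have : x ∈ {x | P x} := hPC ▸ mem_sUnion_of_mem hxI hI
    exact this

end IsOMinimalRealField

/-! ### Alternating definable families -/

theorem defPred_realize {ι : Type} (φ : L.Formula ι) : DefPred L fun v : ι → ℝ => φ.Realize v :=
  (Set.empty_definable_iff.2 ⟨φ, rfl⟩ : (∅ : Set ℝ).Definable L {v | φ.Realize v}).mono
    (empty_subset _)

/-- Every window of length `50` that starts in `[0, Y]` contains the left end point of a unit
interval inside `B` and that of a unit interval outside `B`. The sets `Re σ_lam(1 + i y) > 0` have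
this property because their pattern has period about `6 π`. -/
def Alternates (B : ℝ → Prop) (Y : ℝ) : Prop :=
  ∀ y, 0 ≤ y → y ≤ Y →
    (∃ u, y ≤ u ∧ u ≤ y + 50 ∧ ∀ w, u ≤ w → w ≤ u + 1 → B w) ∧
    ∃ u, y ≤ u ∧ u ≤ y + 50 ∧ ∀ w, u ≤ w → w ≤ u + 1 → ¬ B w

/-- If `T Y y` holds for each large `y` once `Y` is large, then it holds simultaneously on a finite
grid, and a unit interval cannot avoid a grid of mesh `1`. -/
theorem false_of_eventually_of_unit_gaps {T : ℝ → ℝ → Prop} {c : ℝ}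
    (hT : ∀ y, c ≤ y → ∀ᶠ Y in atTop, T Y y)
    (hgap : ∀ᶠ Y in atTop, ∃ u, c ≤ u ∧ u ≤ c + 50 ∧ ∀ w, u ≤ w → w ≤ u + 1 → ¬ T Y w) :
    False := by
  have hgrid : ∀ᶠ Y in atTop, ∀ i ≤ 50, T Y (c + (i : ℕ)) :=
    (finite_le_nat 50).eventually_all.2 fun i _ => hT _ (by simp)
  obtain ⟨Y, hY, u, hcu, huc, hu⟩ := (hgrid.and hgap).exists
  have h0 : 0 ≤ u - c := by linarith
  refine hu (c + (⌈u - c⌉₊ : ℕ)) (by linarith [Nat.le_ceil (u - c)])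
    (by linarith [Nat.ceil_lt_add_one h0]) (hY _ (Nat.ceil_le.2 ?_))
  push_cast
  linarith

namespace IsOMinimalRealField

/-- No definable family of subsets of the line alternates on arbitrarily long intervals. The proof
selects one member for each length `Y` by definable choice and looks at the pointwise limit of these
sets as `Y → ∞`. The limit is definable, hence eventually constant, so on a far away window almost
all selected sets agree with a constant at each point of a finite grid. -/
theorem not_forall_exists_alternates (h : IsOMinimalRealField L) {k : ℕ}
    {A : (Fin k → ℝ) → ℝ → Prop}
    (hA : DefPred L fun v : Option (Fin k) → ℝ => A (fun i => v (some i)) (v none)) :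
    ¬ ∀ Y, ∃ b, Alternates (A b) Y := by
  intro hex
  have hunit : ∀ {B : (Fin k → ℝ) → ℝ → Prop},
      (DefPred L fun v : Option (Fin k) → ℝ => B (fun i => v (some i)) (v none)) →
      DefPred L fun v : Option (Fin 1 ⊕ Fin k) → ℝ => ∃ u, v none ≤ u ∧ u ≤ v none + 50 ∧
        ∀ w, u ≤ w → w ≤ u + 1 → B (fun i => v (some (Sum.inr i))) w := fun hB =>
    .ex <| .and (h.defPred_le (defTerm_var _) (defTerm_var _)) <|
      .and (h.defPred_le (defTerm_var _) (h.defTerm_add (defTerm_var _) (defTerm_const _))) <|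
      .all <| .imp (h.defPred_le (defTerm_var _) (defTerm_var _)) <|
      .imp (h.defPred_le (defTerm_var _) (h.defTerm_add (defTerm_var _) (defTerm_const _))) <|
      hB.subst (fun i => some (some (some (Sum.inr i)))) none
  have hP : DefPred L fun v : Fin 1 ⊕ Fin k → ℝ =>
      Alternates (A fun i => v (Sum.inr i)) (v (Sum.inl 0)) :=
    .all <| .imp (h.defPred_le (defTerm_const _) (defTerm_var _)) <|
      .imp (h.defPred_le (defTerm_var _) (defTerm_var _)) <|
      .and (hunit hA) (hunit (B := fun b w => ¬ A b w) hA.not)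
  obtain ⟨Q, hQ, hQP, huniq, hQex⟩ := h.exists_definable_choice k
    (P := fun (v : Fin 1 → ℝ) b => Alternates (A b) (v 0)) hP
  -- the set selected for the length `Y`
  let S : ℝ → ℝ → Prop := fun Y y => ∃ b, Q (fun _ => Y) b ∧ A b y
  have hS : DefPred L fun v : Fin 2 → ℝ => S (v 0) (v 1) := by
    refine .exists_tuple (.and ?_ (hA.subst Sum.inr (Sum.inl 1)))
    exact hQ.comap (Sum.elim (fun _ => Sum.inl 0) Sum.inr : Fin 1 ⊕ Fin k → Fin 2 ⊕ Fin k)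
  have halt : ∀ Y, Alternates (S Y) Y := by
    intro Y
    obtain ⟨b, hb⟩ := hQex (fun _ => Y) (hex Y)
    have hSA : S Y = A b := by
      funext y
      refine propext ⟨fun ⟨b', hb', hy⟩ => ?_, fun hy => ⟨b, hb, hy⟩⟩
      rwa [huniq _ _ _ hb hb']
    rw [hSA]
    exact hQP _ _ hb
  have hdich : ∀ y, (∀ᶠ Y in atTop, S Y y) ∨ ∀ᶠ Y in atTop, ¬ S Y y := by
    intro y
    refine h.eventually_or_eventually_not ?_
    have h1 : DefPred L fun v : Fin 1 → ℝ => ∃ x, x = y ∧ S (v 0) x :=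
      .ex (.and (h.defPred_eq (defTerm_var _) (defTerm_const _))
        (hS.comap (![some 0, none] : Fin 2 → Option (Fin 1))))
    exact h1.congr fun v => by simp
  have hlim : DefPred L fun v : Fin 1 → ℝ => ∀ᶠ Y in atTop, S Y (v 0) := by
    have h1 : DefPred L fun v : Fin 1 → ℝ => ∃ Y₀, ∀ Y, Y₀ ≤ Y → S Y (v 0) :=
      .ex <| .all <| .imp (h.defPred_le (defTerm_var _) (defTerm_var _))
        (hS.comap (![none, some (some 0)] : Fin 2 → Option (Option (Fin 1))))
    exact h1.congr fun v => eventually_atTop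
  rcases h.eventually_or_eventually_not (P := fun y => ∀ᶠ Y in atTop, S Y y) hlim with hin | hout
  · obtain ⟨c, hc⟩ := eventually_atTop.1 (hin.and (eventually_ge_atTop 0))
    refine false_of_eventually_of_unit_gaps (fun y hy => (hc y hy).1) ?_
    filter_upwards [eventually_ge_atTop c] with Y hY
    exact (halt Y c (hc c le_rfl).2 hY).2
  · obtain ⟨c, hc⟩ := eventually_atTop.1 (hout.and (eventually_ge_atTop 0))
    refine false_of_eventually_of_unit_gaps (T := fun Y y => ¬ S Y y)
      (fun y hy => (hdich y).resolve_left (hc y hy).1) ?_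
    filter_upwards [eventually_ge_atTop c] with Y hY
    simpa only [not_not] using (halt Y c (hc c le_rfl).2 hY).1

end IsOMinimalRealField

theorem neBot_nhdsWithin_legendreDomain : (𝓝[legendreDomain] (0 : ℂ)).NeBot := by
  rw [← mem_closure_iff_nhdsWithin_neBot, Metric.mem_closure_iff]
  intro ε hε
  have h1 : 0 < min (ε / 2) (1 / 2) := by positivity
  have h2 : min (ε / 2) (1 / 2) ≤ 1 / 2 := min_le_right _ _
  have h3 : min (ε / 2) (1 / 2) ≤ ε / 2 := min_le_left _ _
  set t := min (ε / 2) (1 / 2)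
  have hn : ‖(t : ℂ)‖ = t := by rw [Complex.norm_real, Real.norm_eq_abs, abs_of_pos h1]
  have hn1 : ‖1 - (t : ℂ)‖ = 1 - t := by
    rw [← Complex.ofReal_one, ← Complex.ofReal_sub, Complex.norm_real, Real.norm_eq_abs,
      abs_of_pos (by linarith)]
  refine ⟨t, ⟨by exact_mod_cast h1.ne', ?_, by rw [hn]; linarith, by rw [hn1]; linarith,
    by simpa using h2⟩, ?_⟩
  · intro h
    have : t = 1 := by exact_mod_cast h
    linarith
  · rw [dist_zero_left, hn]
    linarith

/-- The sign of `Re σ_lam` along `1 + i y` alternates on `[0, Y]` as soon as `lam` is small. -/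
theorem exists_alternates (Y : ℝ) : ∃ lam ∈ legendreDomain,
    Alternates (fun y => (⟨1, y⟩ : ℂ) ∈ fundParallelogram lam ∧ 0 < (sigma lam ⟨1, y⟩).re) Y := by
  have hpi := Real.pi_gt_three
  have hpi' := Real.pi_lt_d2
  set N := ⌈Y / (6 * Real.pi)⌉₊
  have hev : ∀ᶠ lam in 𝓝[legendreDomain] 0, ∀ j ≤ N,
      (∀ y ∈ Icc (6 * Real.pi * ((j : ℕ) + 1) - 3 / 2) (6 * Real.pi * (j + 1) + 3 / 2),
        (⟨1, y⟩ : ℂ) ∈ fundParallelogram lam ∧ 0 < (sigma lam ⟨1, y⟩).re) ∧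
      ∀ y ∈ Icc (6 * Real.pi * (j + 1) + 3 * Real.pi - 3 / 2)
        (6 * Real.pi * (j + 1) + 3 * Real.pi + 3 / 2),
        (⟨1, y⟩ : ℂ) ∈ fundParallelogram lam ∧ (sigma lam ⟨1, y⟩).re < 0 :=
    (finite_le_nat N).eventually_all.2 fun j _ =>
      (eventually_re_sigma_pos j).and (eventually_re_sigma_neg j)
  have := neBot_nhdsWithin_legendreDomain
  obtain ⟨lam, hlam, hmem⟩ := (hev.and self_mem_nhdsWithin).exists
  refine ⟨lam, hmem, fun y hy0 hyY => ?_⟩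
  have h6 : 0 < 6 * Real.pi := by positivity
  have hj1 := Nat.le_ceil (y / (6 * Real.pi))
  have hj2 := Nat.ceil_lt_add_one (show 0 ≤ y / (6 * Real.pi) by positivity)
  have hjN : ⌈y / (6 * Real.pi)⌉₊ ≤ N := Nat.ceil_mono (by gcongr)
  obtain ⟨hpos, hneg⟩ := hlam _ hjN
  set j := ⌈y / (6 * Real.pi)⌉₊
  rw [div_le_iff₀ h6] at hj1
  rw [← sub_lt_iff_lt_add, lt_div_iff₀ h6] at hj2
  -- both intervals start at most `15 π < 50` to the right of `y`
  constructor
  · refine ⟨6 * Real.pi * (j + 1) - 3 / 2, by nlinarith, by nlinarith, fun w h1 h2 => ?_⟩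
    exact hpos w ⟨h1, by linarith⟩
  · refine ⟨6 * Real.pi * (j + 1) + 3 * Real.pi - 3 / 2, by nlinarith, by nlinarith,
      fun w h1 h2 h => ?_⟩
    exact (hneg w ⟨h1, by linarith⟩).2.not_gt h.2

theorem IsOMinimalRealField.not_definesSigma (h : IsOMinimalRealField L) {k : ℕ}
    (φ : L.Formula (Fin 4 ⊕ Fin k)) : ¬ DefinesSigma φ := by
  intro hφ
  let A : (Fin k → ℝ) → ℝ → Prop := fun b y =>
    ∃ x, ∃ w₀, ∃ w₁, x = 1 ∧ 0 < w₀ ∧ φ.Realize (Sum.elim ![x, y, w₀, w₁] b)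
  have hA : DefPred L fun v : Option (Fin k) → ℝ => A (fun i => v (some i)) (v none) := by
    refine .ex <| .ex <| .ex <| .and (h.defPred_eq (defTerm_var _) (defTerm_const _)) <|
      .and (h.defPred_lt (defTerm_const _) (defTerm_var _)) ?_
    refine ((defPred_realize φ).comap (Sum.elim ![some (some none), some (some (some none)),
      some none, none] fun i => some (some (some (some i))))).congr fun v => ?_
    refine iff_of_eq (congrArg _ (funext fun s => ?_))
    rcases s with s | s
    · fin_cases s <;> rfl
    · rfl
  refine h.not_forall_exists_alternates hA fun Y => ?_
  obtain ⟨lam, hlam, halt⟩ := exists_alternates Y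
  obtain ⟨b, hb⟩ := hφ lam hlam
  refine ⟨b, ?_⟩
  convert! halt using 1
  funext y
  refine propext ⟨?_, fun ⟨h1, h2⟩ => ?_⟩
  · rintro ⟨x, w₀, w₁, rfl, hw, hr⟩
    obtain ⟨h1, h2⟩ := (hb _).1 hr
    simp only [Matrix.cons_val] at h1 h2
    exact ⟨h1, by rw [h2]; exact hw⟩
  · exact ⟨1, (sigma lam ⟨1, y⟩).re, (sigma lam ⟨1, y⟩).im, rfl, h2, (hb _).2 ⟨h1, rfl⟩⟩

end SigmaUniform

end

theorem mainTheorem9 :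
    (∃ θ : SigmaUniform.fieldTwoLang.Formula (Fin 1), ∀ n : ℕ, ∃ ε : ℝ, 0 < ε ∧
      ∀ lam ∈ SigmaUniform.legendreDomain, ‖lam‖ < ε →
        (n : ℕ∞) ≤ ENat.card (ConnectedComponents (SigmaUniform.definedSet θ
          ((SigmaUniform.fundParallelogram lam).indicator (SigmaUniform.sigma lam)))) ∧
        (n : ℕ∞) ≤ ENat.card (ConnectedComponents (SigmaUniform.definedSet θ
          (SigmaUniform.sigma lam)))) ∧
    (∀ (L : FirstOrder.Language.{u, v}) [L.Structure ℝ], SigmaUniform.IsOMinimalRealField L →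
      ¬ ∃ (k : ℕ) (φ : L.Formula (Fin 4 ⊕ Fin k)), SigmaUniform.DefinesSigma φ) :=
  ⟨SigmaUniform.exists_formula_forall_le_card_connectedComponents,
    fun _ _ h ⟨_, φ, hφ⟩ => h.not_definesSigma φ hφ⟩
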